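/- **Theorem 4.1.** Let $n\ge 2$ and $p\ge 0$ be integers, let $(N^{n+p},\bar g)$ be a Riemannian manifold of constant sectional curvature $\tilde c$, and let $M^n$ be an $n$-dimensional (immersed) submanifold of $N$ with the induced metric $g$. Let $h$ be its second fundamental form and, for a normal vector $\xi$, let $A_\xi$ be the shape operator, $g(A_\xi X,Y)=\bar g(h(X,Y),\xi)$. For $x\in M$ and orthonormal bases $e_1,\dots,e_n$ of $T_xM$, put $$\rho(x)=\frac{2}{n(n-1)}\sum_{i<j}K(e_i\wedge e_j),\qquad \mathcal C_x=\frac1n\sum_{i,j=1}^n\|h(e_i,e_j)\|^2 ,$$ where $K$ is the sectional curvature of $M$; for an $l$-dimensional subspace $L\subseteq T_xM$ with orthonormal basis $e_1,\dots,e_l$ put $\mathcal C(L)=\frac1l\sum_{i,j=1}^l\|h(e_i,e_j)\|^2$; and let $$[\delta_C(n-1)]_x=\tfrac12\,\mathcal C_x+\frac{n+1}{2n}\inf\{\mathcal C(L)\mid L\text{ a hyperplane of }T_xM\}.$$ Then at every point $x\in M$ $$\rho(x)\le[\delta_C(n-1)]_x+\tilde c .$$ Moreover, equality holds at $x$ if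 and only if all of the following hold at $x$: (i) $M$ is invariantly quasi-umbilical at $x$, i.e. there are an orthonormal basis $\xi_{n+1},\dots,\xi_{n+p}$ of the normal space and a unit vector $e\in T_xM$ such that each $A_{\xi_r}$ has $e$ as an eigenvector and is a multiple of the identity on the orthogonal complement of $e$ in $T_xM$; (ii) the normal connection is trivial at $x$, i.e. its curvature tensor $R^\perp$ vanishes at $x$; (iii) there are orthonormal bases $e_1,\dots,e_n$ of $T_xM$ and $e_{n+1},\dots,e_{n+p}$ of the normal space $T_x^\perp M$ and a real number $\lambda$ such that, with respect to $e_1,\dots,e_n$, $$A_{e_{n+1}}=\operatorname{diag}(\lambda,\dots,\lambda,2\lambda),\qquad A_{e_{n+2}}=\dots=A_{e_{n+p}}=0$$ (for $p=0$ the condition on the shape operators is void). In particular, equality holds at every point of $M$ if and only if (i)–(iii) hold at every point of $M$. -/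

import Mathlib

open scoped Manifold ContDiff Topology InnerProductSpace
open Bundle

noncomputable section

namespace Casorati

/-! ## Riemannian geometry in a coordinate domain

`G : F → F →L[ℝ] F →L[ℝ] ℝ` is the expression of a Riemannian metric in a chart, and `φ : E → F` is
the expression of a map between manifolds in charts. Vectors of the model space stand for the
coordinate vector fields with these constant components; any two of these commute. -/

section Chart

variable {E F : Type*} [NormedAddCommGroup E] [NormedSpace ℝ E]
  [NormedAddCommGroup F] [NormedSpace ℝ F]

/-- The Christoffel symbols (of the first kind) of the Levi-Civita connection: the linear form
`z ↦ (∂_v G(w, z) + ∂_w G(v, z) - ∂_z G(v, w)) / 2`. -/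
def christoffelFirst (G : F → F →L[ℝ] F →L[ℝ] ℝ) (u v w : F) : F →L[ℝ] ℝ :=
  (1 / 2 : ℝ) • (fderiv ℝ G u v w + fderiv ℝ G u w v - ((fderiv ℝ G u).flip v).flip w)

/-- The Christoffel symbols of the Levi-Civita connection: `christoffel G u v w = Γ_u(v, w)` is
the vector with `G u (Γ_u(v, w)) z = christoffelFirst G u v w z` for all `z`. -/
def christoffel (G : F → F →L[ℝ] F →L[ℝ] ℝ) (u v w : F) : F :=
  (G u).inverse (christoffelFirst G u v w)

/-- The Levi-Civita covariant derivative `∇_v V` at `u` of a vector field `V` along `φ`. For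
`φ = id` this is the Levi-Civita connection on vector fields. -/
def covDerivAlong (G : F → F →L[ℝ] F →L[ℝ] ℝ) (φ : E → F) (V : E → F) (u v : E) : F :=
  fderiv ℝ V u v + christoffel G (φ u) (fderiv ℝ φ u v) (V u)

/-- The Riemann curvature tensor `R(v, w)z = ∇_v ∇_w z - ∇_w ∇_v z` (coordinate fields commute). -/
def chartCurvature (G : F → F →L[ℝ] F →L[ℝ] ℝ) (u v w z : F) : F :=
  covDerivAlong G id (fun u' ↦ covDerivAlong G id (fun _ ↦ z) u' w) u v
    - covDerivAlong G id (fun u' ↦ covDerivAlong G id (fun _ ↦ z) u' v) u w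

/-- The second fundamental form `h(v, w) = ∇̄_v (dφ w) - dφ (∇_v w)` (Gauss formula), where `∇̄` is
the Levi-Civita connection of `G` and `∇` that of the metric `g` on the source. In coordinates:
`D²φ(v, w) + Γ̄(dφ v, dφ w) - dφ (Γ(v, w))`. -/
def chartSecondFundamentalForm (g : E → E →L[ℝ] E →L[ℝ] ℝ) (G : F → F →L[ℝ] F →L[ℝ] ℝ)
    (φ : E → F) (u v w : E) : F :=
  fderiv ℝ (fderiv ℝ φ) u v w + christoffel G (φ u) (fderiv ℝ φ u v) (fderiv ℝ φ u w)
    - fderiv ℝ φ u (christoffel g u v w)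

/-- The Gauss formula. -/
theorem chartSecondFundamentalForm_eq (g : E → E →L[ℝ] E →L[ℝ] ℝ) (G : F → F →L[ℝ] F →L[ℝ] ℝ)
    (φ : E → F) (u : E) (hφ : DifferentiableAt ℝ (fderiv ℝ φ) u) (v w : E) :
    chartSecondFundamentalForm g G φ u v w =
      covDerivAlong G φ (fun u' ↦ fderiv ℝ φ u' w) u v
        - fderiv ℝ φ u (covDerivAlong g id (fun _ ↦ w) u v) := by
  have h : fderiv ℝ (fun u' ↦ fderiv ℝ φ u' w) u v = fderiv ℝ (fderiv ℝ φ) u v w := by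
    rw [fderiv_clm_apply hφ (differentiableAt_const w)]
    simp
  simp [chartSecondFundamentalForm, covDerivAlong, h]

set_option synthInstance.maxHeartbeats 200000 in
theorem christoffel_add_left (G : F → F →L[ℝ] F →L[ℝ] ℝ) (u v v' w : F) :
    christoffel G u (v + v') w = christoffel G u v w + christoffel G u v' w := by
  rw [christoffel, christoffel, christoffel, ← map_add]
  congr 1
  ext z
  simp [christoffelFirst]
  ring

set_option synthInstance.maxHeartbeats 200000 in
theorem christoffel_smul_left (G : F → F →L[ℝ] F →L[ℝ] ℝ) (a : ℝ) (u v w : F) :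
    christoffel G u (a • v) w = a • christoffel G u v w := by
  rw [christoffel, christoffel, ← map_smul]
  congr 1
  ext z
  simp [christoffelFirst]
  ring

set_option synthInstance.maxHeartbeats 200000 in
theorem chartSecondFundamentalForm_add_left (g : E → E →L[ℝ] E →L[ℝ] ℝ)
    (G : F → F →L[ℝ] F →L[ℝ] ℝ) (φ : E → F) (u v v' w : E) :
    chartSecondFundamentalForm g G φ u (v + v') w =
      chartSecondFundamentalForm g G φ u v w + chartSecondFundamentalForm g G φ u v' w := by
  simp only [chartSecondFundamentalForm, map_add, christoffel_add_left, add_apply]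
  abel

set_option synthInstance.maxHeartbeats 200000 in
theorem chartSecondFundamentalForm_smul_left (g : E → E →L[ℝ] E →L[ℝ] ℝ)
    (G : F → F →L[ℝ] F →L[ℝ] ℝ) (φ : E → F) (a : ℝ) (u v w : E) :
    chartSecondFundamentalForm g G φ u (a • v) w =
      a • chartSecondFundamentalForm g G φ u v w := by
  simp only [chartSecondFundamentalForm, map_smul, christoffel_smul_left, smul_apply, smul_add,
    smul_sub]

/-- The normal part of `y` at `φ u`, for the isometric immersion `φ` from `g` to `G`: the vector
`y - dφ z` where `g u z = G (φ u) y (dφ ·)`. -/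
def chartNormalPart (g : E → E →L[ℝ] E →L[ℝ] ℝ) (G : F → F →L[ℝ] F →L[ℝ] ℝ)
    (φ : E → F) (u : E) (y : F) : F :=
  y - fderiv ℝ φ u ((g u).inverse ((G (φ u) y) ∘L fderiv ℝ φ u))

/-- The normal connection: `∇^⊥_v ξ` is the normal part of `∇̄_v ξ`. -/
def chartNormalDeriv (g : E → E →L[ℝ] E →L[ℝ] ℝ) (G : F → F →L[ℝ] F →L[ℝ] ℝ)
    (φ : E → F) (ξ : E → F) (u v : E) : F :=
  chartNormalPart g G φ u (covDerivAlong G φ ξ u v)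

/-- The curvature of the normal connection: `R^⊥(v, w)ξ = ∇^⊥_v ∇^⊥_w ξ - ∇^⊥_w ∇^⊥_v ξ`. -/
def chartNormalCurvature (g : E → E →L[ℝ] E →L[ℝ] ℝ) (G : F → F →L[ℝ] F →L[ℝ] ℝ)
    (φ : E → F) (ξ : E → F) (u v w : E) : F :=
  chartNormalDeriv g G φ (fun u' ↦ chartNormalDeriv g G φ ξ u' w) u v
    - chartNormalDeriv g G φ (fun u' ↦ chartNormalDeriv g G φ ξ u' v) u w

end Chart

/-! ## Riemannian manifolds

Mathlib's tangent space `T_x M` is the model space, read in the preferred chart at `x`; so the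
coordinate expressions in that chart at the point `x` are tensors on `T_x M`. -/

section Manifold

variable (m : ℕ) {M : Type*} [TopologicalSpace M] [ChartedSpace (EuclideanSpace ℝ (Fin m)) M]
  [RiemannianBundle (fun x : M ↦ TangentSpace (𝓡 m) x)]

instance instFiniteDimensionalTangentSpace (x : M) :
    FiniteDimensional ℝ (TangentSpace (𝓡 m) x) :=
  inferInstanceAs (FiniteDimensional ℝ (EuclideanSpace ℝ (Fin m)))

/-- The Riemannian metric of `M` in the preferred chart at `x`. -/
def chartMetric (x : M) (u : EuclideanSpace ℝ (Fin m)) :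
    EuclideanSpace ℝ (Fin m) →L[ℝ] EuclideanSpace ℝ (Fin m) →L[ℝ] ℝ :=
  (innerSL ℝ (E := TangentSpace (𝓡 m) ((extChartAt (𝓡 m) x).symm u))).bilinearComp
    (mfderiv 𝓘(ℝ, EuclideanSpace ℝ (Fin m)) (𝓡 m) (extChartAt (𝓡 m) x).symm u)
    (mfderiv 𝓘(ℝ, EuclideanSpace ℝ (Fin m)) (𝓡 m) (extChartAt (𝓡 m) x).symm u)

/-- The Riemann curvature tensor `R(v, w)z` of `M` at `x`. -/
def curvatureTensor (x : M) (v w z : TangentSpace (𝓡 m) x) : TangentSpace (𝓡 m) x :=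
  chartCurvature (F := EuclideanSpace ℝ (Fin m)) (chartMetric m x) (extChartAt (𝓡 m) x x) v w z

/-- The sectional curvature of the plane spanned by `v` and `w`. -/
def sectionalCurvature (x : M) (v w : TangentSpace (𝓡 m) x) : ℝ :=
  ⟪curvatureTensor m x v w w, v⟫_ℝ / (‖v‖ ^ 2 * ‖w‖ ^ 2 - ⟪v, w⟫_ℝ ^ 2)

/-- The scalar curvature `τ = ∑_{i < j} K(e_i ∧ e_j)`, with `e` an orthonormal basis of `T_x M`. -/
def scalarCurvature (x : M) : ℝ :=
  let e := stdOrthonormalBasis ℝ (TangentSpace (𝓡 m) x)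
  ∑ i, ∑ j, if i < j then sectionalCurvature m x (e i) (e j) else 0

/-- The normalized scalar curvature `ρ = 2τ / (m (m - 1))` of an `m`-dimensional manifold. -/
def normalizedScalarCurvature (x : M) : ℝ :=
  2 * scalarCurvature m x / ((m : ℝ) * ((m : ℝ) - 1))

variable (M) in
/-- All sectional curvatures of `M` are equal to `c`. -/
def HasConstantSectionalCurvature (c : ℝ) : Prop :=
  ∀ (x : M) (v w : TangentSpace (𝓡 m) x), LinearIndependent ℝ ![v, w] →
    sectionalCurvature m x v w = c

end Manifold

/-! ## Submanifolds -/

section Submanifold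

variable (n k : ℕ)
  {M : Type*} [TopologicalSpace M] [ChartedSpace (EuclideanSpace ℝ (Fin n)) M]
  [RiemannianBundle (fun x : M ↦ TangentSpace (𝓡 n) x)]
  {N : Type*} [TopologicalSpace N] [ChartedSpace (EuclideanSpace ℝ (Fin k)) N]
  [RiemannianBundle (fun y : N ↦ TangentSpace (𝓡 k) y)]

/-- `f : M → N` is a smooth isometric immersion: the metric of `M` is induced by that of `N`
(so the differentials of `f` are injective). -/
def IsIsometricImmersion (f : M → N) : Prop :=
  ContMDiff (𝓡 n) (𝓡 k) ∞ f ∧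
    ∀ (x : M) (v w : TangentSpace (𝓡 n) x),
      ⟪mfderiv (𝓡 n) (𝓡 k) f x v, mfderiv (𝓡 n) (𝓡 k) f x w⟫_ℝ = ⟪v, w⟫_ℝ

/-- The normal space `T_x^⊥ M` inside `T_{f x} N`. -/
def normalSpace (f : M → N) (x : M) : Submodule ℝ (TangentSpace (𝓡 k) (f x)) :=
  (LinearMap.range (mfderiv (𝓡 n) (𝓡 k) f x : TangentSpace (𝓡 n) x →ₗ[ℝ] _))ᗮ

/-- The second fundamental form `h(v, w)` at `x`. -/
def secondFundamentalForm (f : M → N) (x : M) (v w : TangentSpace (𝓡 n) x) :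
    TangentSpace (𝓡 k) (f x) :=
  chartSecondFundamentalForm (E := EuclideanSpace ℝ (Fin n)) (F := EuclideanSpace ℝ (Fin k))
    (chartMetric n x) (chartMetric k (f x))
    (writtenInExtChartAt (𝓡 n) (𝓡 k) x f) (extChartAt (𝓡 n) x x) v w

/-- The shape operator `A_ξ` at `x`: the linear map with `⟪A_ξ v, w⟫ = ⟪h(v, w), ξ⟫`, that is,
`A_ξ v = ∑ i, ⟪h(v, e_i), ξ⟫ e_i` with `e` an orthonormal basis of `T_x M`. -/
def shapeOperator (f : M → N) (x : M) (ξ : TangentSpace (𝓡 k) (f x)) :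
    TangentSpace (𝓡 n) x →ₗ[ℝ] TangentSpace (𝓡 n) x where
  toFun v :=
    let e := stdOrthonormalBasis ℝ (TangentSpace (𝓡 n) x)
    ∑ i, ⟪secondFundamentalForm n k f x v (e i), ξ⟫_ℝ • e i
  map_add' v w := by
    have h (z : TangentSpace (𝓡 n) x) : secondFundamentalForm n k f x (v + w) z =
        secondFundamentalForm n k f x v z + secondFundamentalForm n k f x w z :=
      chartSecondFundamentalForm_add_left (E := EuclideanSpace ℝ (Fin n))
        (F := EuclideanSpace ℝ (Fin k)) _ _ _ _ _ _ _
    simp only [h, inner_add_left, add_smul, Finset.sum_add_distrib]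
  map_smul' a v := by
    have h (z : TangentSpace (𝓡 n) x) : secondFundamentalForm n k f x (a • v) z =
        a • secondFundamentalForm n k f x v z :=
      chartSecondFundamentalForm_smul_left (E := EuclideanSpace ℝ (Fin n))
        (F := EuclideanSpace ℝ (Fin k)) _ _ _ _ _ _ _
    simp only [h, inner_smul_left, mul_smul, Finset.smul_sum, RingHom.id_apply, conj_trivial]

/-- The Casorati curvature `C = (1/n) ∑_{i,j} ‖h(e_i, e_j)‖²`, with `e` an orthonormal basis of
`T_x M`. -/
def casoratiCurvature (f : M → N) (x : M) : ℝ :=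
  let e := stdOrthonormalBasis ℝ (TangentSpace (𝓡 n) x)
  (1 / (n : ℝ)) * ∑ i, ∑ j, ‖secondFundamentalForm n k f x (e i) (e j)‖ ^ 2

/-- The Casorati curvature `C(L) = (1/l) ∑_{i,j} ‖h(e_i, e_j)‖²` of an `l`-dimensional subspace `L`
of `T_x M`, with `e` an orthonormal basis of `L`. -/
def casoratiCurvatureOf (f : M → N) (x : M) (L : Submodule ℝ (TangentSpace (𝓡 n) x)) : ℝ :=
  let e := stdOrthonormalBasis ℝ L
  (1 / (Module.finrank ℝ L : ℝ)) *
    ∑ i, ∑ j, ‖secondFundamentalForm n k f x (e i : TangentSpace (𝓡 n) x) (e j)‖ ^ 2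

/-- The normalized `δ`-Casorati curvature
`δ_C(n-1) = C/2 + (n+1)/(2n) · inf {C(L) | L a hyperplane of T_x M}`. -/
def deltaCasorati (f : M → N) (x : M) : ℝ :=
  (1 / 2) * casoratiCurvature n k f x + ((n : ℝ) + 1) / (2 * (n : ℝ)) *
    sInf {c : ℝ | ∃ L : Submodule ℝ (TangentSpace (𝓡 n) x),
      Module.finrank ℝ L + 1 = n ∧ c = casoratiCurvatureOf n k f x L}

/-- `M` is invariantly quasi-umbilical at `x`: there are an orthonormal basis `ξ` of the normal
space (`k = n + p`) and a common unit vector `e` such that every shape operator `A_{ξ_r}` has `e` as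
an eigenvector and acts on the hyperplane orthogonal to `e` as a scalar. -/
def IsInvariantlyQuasiUmbilicalAt (p : ℕ) (f : M → N) (x : M) : Prop :=
  ∃ (ξ : OrthonormalBasis (Fin p) ℝ (normalSpace n k f x)) (e : TangentSpace (𝓡 n) x), ‖e‖ = 1 ∧
    ∀ r : Fin p, ∃ a b : ℝ,
      shapeOperator n k f x (ξ r : TangentSpace (𝓡 k) (f x)) e = b • e ∧
      ∀ v : TangentSpace (𝓡 n) x, ⟪v, e⟫_ℝ = 0 →
        shapeOperator n k f x (ξ r : TangentSpace (𝓡 k) (f x)) v = a • v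

/-- The normal connection is trivial (flat) at `x`: the normal curvature tensor vanishes at `x`,
i.e. `R^⊥(v, w)ξ = 0` at `x` for all smooth normal fields `ξ` near `x`. -/
def HasTrivialNormalConnectionAt (f : M → N) (x : M) : Prop :=
  let φ := writtenInExtChartAt (𝓡 n) (𝓡 k) x f
  let u := extChartAt (𝓡 n) x x
  ∀ ξ : EuclideanSpace ℝ (Fin n) → EuclideanSpace ℝ (Fin k), ContDiffAt ℝ ∞ ξ u →
    (∀ᶠ u' in 𝓝 u, ∀ z, chartMetric k (f x) (φ u') (ξ u') (fderiv ℝ φ u' z) = 0) →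
    ∀ v w, chartNormalCurvature (chartMetric n x) (chartMetric k (f x)) φ ξ u v w = 0

end Submanifold

end Casorati

end

/-!
By the Gauss equation the scalar curvature of `M` at `x` is determined by `c` and the second
fundamental form `h`, and the inequality becomes `2 / (n + 1) * ‖tr h‖² ≤ ‖h‖² + ‖h|_L‖²` for every
hyperplane `L` of the tangent space. With `e` a unit normal of `L`, the difference of the two sides
is `‖D‖² + ‖D|_L‖²`, where `D = h - (g + e ⊗ e) ⊗ tr h / (n + 1)`. The infimum over hyperplanes is
attained, so equality means that `h = (g + e ⊗ e) ⊗ Λ` for some unit vector `e` and some normal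
vector `Λ`. All shape operators are then multiples of `v ↦ v + ⟪e, v⟫ e`, so they commute, and the
Ricci equation in a space form gives a flat normal connection.
-/

noncomputable section

namespace Casorati

set_option maxSynthPendingDepth 3

section ChartMetric

variable {E F : Type*} [NormedAddCommGroup E] [NormedSpace ℝ E]
  [NormedAddCommGroup F] [NormedSpace ℝ F]

/-- `G` is the coordinate expression near `y` of a (pseudo-)Riemannian metric of class `C³`. Of
positivity, only the nondegeneracy at `y` is recorded. -/
structure IsChartMetricAt (G : F → F →L[ℝ] F →L[ℝ] ℝ) (y : F) : Prop where
  contDiffAt : ContDiffAt ℝ 3 G y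
  eventually_comm : ∀ᶠ y' in 𝓝 y, ∀ v w, G y' v w = G y' w v
  isInvertible : (G y).IsInvertible

variable {G : F → F →L[ℝ] F →L[ℝ] ℝ} {y : F}

theorem IsChartMetricAt.eventually [CompleteSpace F] (hG : IsChartMetricAt G y) :
    ∀ᶠ y' in 𝓝 y, IsChartMetricAt G y' := by
  filter_upwards [hG.contDiffAt.eventually (by decide), hG.eventually_comm.eventually_nhds,
    hG.contDiffAt.continuousAt.eventually
      (ContinuousLinearEquiv.isOpen.mem_nhds hG.isInvertible)] with y' hsmooth hcomm hinv
  exact ⟨hsmooth, hcomm, hinv⟩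

theorem IsChartMetricAt.apply_comm (hG : IsChartMetricAt G y) (v w : F) : G y v w = G y w v :=
  hG.eventually_comm.self_of_nhds v w

theorem IsChartMetricAt.differentiableAt (hG : IsChartMetricAt G y) : DifferentiableAt ℝ G y :=
  hG.contDiffAt.differentiableAt (by norm_num)

theorem IsChartMetricAt.ext (hG : IsChartMetricAt G y) {a b : F} (h : ∀ z, G y a z = G y b z) :
    a = b :=
  hG.isInvertible.injective (ContinuousLinearMap.ext h)

theorem fderiv_apply_apply (hG : DifferentiableAt ℝ G y) (a v w : F) :
    fderiv ℝ (fun y' ↦ G y' v w) y a = fderiv ℝ G y a v w := by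
  rw [((hG.hasFDerivAt.clm_apply (hasFDerivAt_const v y)).clm_apply (hasFDerivAt_const w y)).fderiv]
  simp

theorem IsChartMetricAt.fderiv_comm (hG : IsChartMetricAt G y) (a v w : F) :
    fderiv ℝ G y a v w = fderiv ℝ G y a w v := by
  have hcomm : (fun y' ↦ G y' v w) =ᶠ[𝓝 y] fun y' ↦ G y' w v :=
    hG.eventually_comm.mono fun _ h ↦ h v w
  rw [← fderiv_apply_apply hG.differentiableAt, hcomm.fderiv_eq,
    fderiv_apply_apply hG.differentiableAt]

theorem IsChartMetricAt.christoffelFirst_comm (hG : IsChartMetricAt G y) (v w : F) :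
    christoffelFirst G y v w = christoffelFirst G y w v := by
  ext z
  simp only [christoffelFirst, smul_apply, sub_apply, add_apply, ContinuousLinearMap.flip_apply]
  rw [hG.fderiv_comm z v w, add_comm]

theorem IsChartMetricAt.christoffel_comm (hG : IsChartMetricAt G y) (v w : F) :
    christoffel G y v w = christoffel G y w v := by
  rw [christoffel, christoffel, hG.christoffelFirst_comm]

theorem IsChartMetricAt.apply_christoffel (hG : IsChartMetricAt G y) (v w z : F) :
    G y (christoffel G y v w) z = christoffelFirst G y v w z := by
  rw [christoffel, hG.isInvertible.self_apply_inverse]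

/-- The Christoffel symbols of the Levi-Civita connection, as a continuous bilinear map. -/
def christoffelCLM (G : F → F →L[ℝ] F →L[ℝ] ℝ) (y : F) : F →L[ℝ] F →L[ℝ] F :=
  (ContinuousLinearMap.compL ℝ F (F →L[ℝ] ℝ) F (G y).inverse) ∘L
    ((1 / 2 : ℝ) • (fderiv ℝ G y + (fderiv ℝ G y).flip
      - ((ContinuousLinearMap.flipₗᵢ ℝ F F ℝ).toContinuousLinearEquiv :
        (F →L[ℝ] F →L[ℝ] ℝ) →L[ℝ] (F →L[ℝ] F →L[ℝ] ℝ)) ∘L (fderiv ℝ G y).flip))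

theorem christoffelCLM_apply (G : F → F →L[ℝ] F →L[ℝ] ℝ) (y v w : F) :
    christoffelCLM G y v w = christoffel G y v w :=
  rfl

theorem IsChartMetricAt.contDiffAt_christoffelCLM [CompleteSpace F] (hG : IsChartMetricAt G y) :
    ContDiffAt ℝ 2 (christoffelCLM G) y := by
  have hderiv : ContDiffAt ℝ 2 (fderiv ℝ G) y := hG.contDiffAt.fderiv_right (by norm_num)
  have hflip : ContDiffAt ℝ 2 (fun y ↦ (fderiv ℝ G y).flip) y :=
    (ContinuousLinearMap.flipₗᵢ ℝ F F (F →L[ℝ] ℝ)).contDiff.contDiffAt.comp y hderiv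
  have hinverse : ContDiffAt ℝ 2 (fun y ↦ (G y).inverse) y :=
    (hG.isInvertible.contDiffAt_map_inverse (n := 2)).comp y (hG.contDiffAt.of_le (by norm_num))
  exact (hinverse.continuousLinearMap_comp (ContinuousLinearMap.compL ℝ F (F →L[ℝ] ℝ) F)).clm_comp
    (contDiffAt_const.fun_smul ((hderiv.add hflip).sub (contDiffAt_const.clm_comp hflip)))

theorem covDerivAlong_eq (G : F → F →L[ℝ] F →L[ℝ] ℝ) (φ V : E → F) (u v : E) :
    covDerivAlong G φ V u v =
      fderiv ℝ V u v + christoffelCLM G (φ u) (fderiv ℝ φ u v) (V u) := by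
  rw [christoffelCLM_apply, covDerivAlong]

theorem covDerivAlong_congr {φ V W : E → F} {u : E} (h : V =ᶠ[𝓝 u] W) (v : E) :
    covDerivAlong G φ V u v = covDerivAlong G φ W u v := by
  rw [covDerivAlong, covDerivAlong, h.fderiv_eq, h.eq_of_nhds]

theorem covDerivAlong_sub {φ V W : E → F} {u : E} (hV : DifferentiableAt ℝ V u)
    (hW : DifferentiableAt ℝ W u) (v : E) :
    covDerivAlong G φ (fun u' ↦ V u' - W u') u v =
      covDerivAlong G φ V u v - covDerivAlong G φ W u v := by
  simp only [covDerivAlong_eq, fderiv_fun_sub hV hW, map_sub, sub_apply]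
  abel

theorem covDerivAlong_id_const (G : F → F →L[ℝ] F →L[ℝ] ℝ) (y v w : F) :
    covDerivAlong G id (fun _ ↦ w) y v = christoffel G y v w := by
  simp [covDerivAlong]

theorem differentiableAt_fderiv {φ : E → F} {u : E} (hφ : ContDiffAt ℝ 2 φ u) :
    DifferentiableAt ℝ (fderiv ℝ φ) u :=
  (hφ.fderiv_right (m := 1) (by norm_num)).differentiableAt (by norm_num)

theorem differentiableAt_covDerivAlong [CompleteSpace F] {φ V : E → F} {u : E}
    (hG : IsChartMetricAt G (φ u)) (hφ : ContDiffAt ℝ 3 φ u) (hV : ContDiffAt ℝ 2 V u) (v : E) :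
    DifferentiableAt ℝ (fun u' ↦ covDerivAlong G φ V u' v) u := by
  simp only [covDerivAlong_eq]
  have hΓ : DifferentiableAt ℝ (fun u ↦ christoffelCLM G (φ u)) u :=
    (hG.contDiffAt_christoffelCLM.differentiableAt (by norm_num)).comp u
      (hφ.differentiableAt (by norm_num))
  have hdφ := differentiableAt_fderiv (hφ.of_le (by norm_num))
  exact ((differentiableAt_fderiv hV).clm_apply (differentiableAt_const v)).add
    ((hΓ.clm_apply (hdφ.clm_apply (differentiableAt_const v))).clm_apply
      (hV.differentiableAt (by norm_num)))

theorem fderiv_metric_apply {φ V W : E → F} {u : E} (hG : IsChartMetricAt G (φ u))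
    (hφ : DifferentiableAt ℝ φ u) (hV : DifferentiableAt ℝ V u) (hW : DifferentiableAt ℝ W u)
    (v : E) :
    fderiv ℝ (fun u' ↦ G (φ u') (V u') (W u')) u v =
      G (φ u) (covDerivAlong G φ V u v) (W u) + G (φ u) (V u) (covDerivAlong G φ W u v) := by
  have hGφ : HasFDerivAt (fun u' ↦ G (φ u')) _ u :=
    hG.differentiableAt.hasFDerivAt.comp u hφ.hasFDerivAt
  rw [((hGφ.clm_apply hV.hasFDerivAt).clm_apply hW.hasFDerivAt).fderiv]
  simp only [covDerivAlong, map_add, add_apply, hG.apply_christoffel,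
    hG.apply_comm (V u) (christoffel _ _ _ _)]
  simp only [christoffelFirst, smul_apply, sub_apply, smul_eq_mul,
    add_apply, ContinuousLinearMap.flip_apply, ContinuousLinearMap.comp_apply]
  rw [hG.fderiv_comm _ (W u) (V u), hG.fderiv_comm (V u) _ (W u), hG.fderiv_comm (W u) _ (V u)]
  ring

theorem fderiv_fderiv_apply {φ : E → F} {u : E} (hφ : DifferentiableAt ℝ (fderiv ℝ φ) u)
    (v w : E) : fderiv ℝ (fun u' ↦ fderiv ℝ φ u' w) u v = fderiv ℝ (fderiv ℝ φ) u v w := by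
  rw [fderiv_clm_apply hφ (differentiableAt_const w)]
  simp

theorem fderiv_fderiv_comm {φ : E → F} {u : E} (hφ : ContDiffAt ℝ 2 φ u) (v w : E) :
    fderiv ℝ (fderiv ℝ φ) u v w = fderiv ℝ (fderiv ℝ φ) u w v :=
  hφ.isSymmSndFDerivAt (by simp) v w

theorem covDerivAlong_fderiv_comm {φ : E → F} {u : E} (hG : IsChartMetricAt G (φ u))
    (hφ : ContDiffAt ℝ 2 φ u) (v w : E) :
    covDerivAlong G φ (fun u' ↦ fderiv ℝ φ u' w) u v =
      covDerivAlong G φ (fun u' ↦ fderiv ℝ φ u' v) u w := by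
  have hdφ := differentiableAt_fderiv hφ
  rw [covDerivAlong, covDerivAlong, fderiv_fderiv_apply hdφ, fderiv_fderiv_apply hdφ,
    fderiv_fderiv_comm hφ, hG.christoffel_comm]

theorem covDerivAlong_covDerivAlong [CompleteSpace F] {φ V : E → F} {u : E}
    (hG : IsChartMetricAt G (φ u)) (hφ : ContDiffAt ℝ 3 φ u) (hV : ContDiffAt ℝ 2 V u) (v w : E) :
    covDerivAlong G φ (fun u' ↦ covDerivAlong G φ V u' w) u v =
      fderiv ℝ (christoffelCLM G) (φ u) (fderiv ℝ φ u v) (fderiv ℝ φ u w) (V u)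
      + christoffelCLM G (φ u) (fderiv ℝ φ u v) (christoffelCLM G (φ u) (fderiv ℝ φ u w) (V u))
      + (fderiv ℝ (fderiv ℝ V) u v w
        + christoffelCLM G (φ u) (fderiv ℝ (fderiv ℝ φ) u v w) (V u)
        + (christoffelCLM G (φ u) (fderiv ℝ φ u w) (fderiv ℝ V u v)
          + christoffelCLM G (φ u) (fderiv ℝ φ u v) (fderiv ℝ V u w))) := by
  have hdV := (differentiableAt_fderiv hV).hasFDerivAt
  have hdφ := (differentiableAt_fderiv (hφ.of_le (by norm_num))).hasFDerivAt
  have hΓ : HasFDerivAt (fun u' ↦ christoffelCLM G (φ u')) _ u :=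
    (hG.contDiffAt_christoffelCLM.differentiableAt (by norm_num)).hasFDerivAt.comp u
      (hφ.differentiableAt (by norm_num)).hasFDerivAt
  rw [covDerivAlong_eq]
  simp only [covDerivAlong_eq]
  rw [((hdV.clm_apply (hasFDerivAt_const w u)).fun_add
    ((hΓ.clm_apply (hdφ.clm_apply (hasFDerivAt_const w u))).clm_apply
      (hV.differentiableAt (by norm_num)).hasFDerivAt)).fderiv]
  simp only [map_add, add_apply, ContinuousLinearMap.comp_apply, ContinuousLinearMap.flip_apply,
    zero_apply, map_zero, zero_add]
  abel

theorem chartCurvature_eq [CompleteSpace F] (hG : IsChartMetricAt G y) (v w z : F) :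
    chartCurvature G y v w z =
      fderiv ℝ (christoffelCLM G) y v w z + christoffelCLM G y v (christoffelCLM G y w z)
      - (fderiv ℝ (christoffelCLM G) y w v z
        + christoffelCLM G y w (christoffelCLM G y v z)) := by
  have hfderiv_id : fderiv ℝ (id : F → F) = fun _ ↦ ContinuousLinearMap.id ℝ F :=
    funext fun _ ↦ fderiv_id
  rw [chartCurvature,
    covDerivAlong_covDerivAlong (φ := id) (u := y) hG contDiffAt_id contDiffAt_const v w,
    covDerivAlong_covDerivAlong (φ := id) (u := y) hG contDiffAt_id contDiffAt_const w v]
  simp [hfderiv_id]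

theorem covDerivAlong_commutator [CompleteSpace F] {φ V : E → F} {u : E}
    (hG : IsChartMetricAt G (φ u)) (hφ : ContDiffAt ℝ 3 φ u) (hV : ContDiffAt ℝ 2 V u) (v w : E) :
    covDerivAlong G φ (fun u' ↦ covDerivAlong G φ V u' w) u v
      - covDerivAlong G φ (fun u' ↦ covDerivAlong G φ V u' v) u w =
      chartCurvature G (φ u) (fderiv ℝ φ u v) (fderiv ℝ φ u w) (V u) := by
  rw [covDerivAlong_covDerivAlong hG hφ hV, covDerivAlong_covDerivAlong hG hφ hV,
    chartCurvature_eq hG, fderiv_fderiv_comm hV, fderiv_fderiv_comm (hφ.of_le (by norm_num))]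
  abel

theorem chartCurvature_add_left [CompleteSpace F] (hG : IsChartMetricAt G y) (v v' w z : F) :
    chartCurvature G y (v + v') w z = chartCurvature G y v w z + chartCurvature G y v' w z := by
  simp only [chartCurvature_eq hG, map_add, add_apply]
  abel

theorem chartCurvature_smul_left [CompleteSpace F] (hG : IsChartMetricAt G y) (a : ℝ) (v w z : F) :
    chartCurvature G y (a • v) w z = a • chartCurvature G y v w z := by
  simp only [chartCurvature_eq hG, map_smul, smul_apply, smul_sub, smul_add]

theorem chartCurvature_swap (G : F → F →L[ℝ] F →L[ℝ] ℝ) (y v w z : F) :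
    chartCurvature G y v w z = - chartCurvature G y w v z := by
  simp only [chartCurvature, neg_sub]

theorem chartCurvature_bianchi [CompleteSpace F] (hG : IsChartMetricAt G y) (v w z : F) :
    chartCurvature G y v w z + chartCurvature G y w z v + chartCurvature G y z v w = 0 := by
  have htorsion (v w z : F) :
      covDerivAlong G id (fun y' ↦ covDerivAlong G id (fun _ ↦ z) y' w) y v =
      covDerivAlong G id (fun y' ↦ covDerivAlong G id (fun _ ↦ w) y' z) y v := by
    apply covDerivAlong_congr
    filter_upwards [hG.eventually] with y' hy'
    rw [covDerivAlong_id_const, covDerivAlong_id_const, hy'.christoffel_comm]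
  simp only [chartCurvature]
  rw [htorsion v w z, htorsion w z v, htorsion z v w]
  abel

theorem fderiv_fderiv_metric_apply [CompleteSpace F] {φ V W : E → F} {u : E}
    (hG : IsChartMetricAt G (φ u)) (hφ : ContDiffAt ℝ 3 φ u) (hV : ContDiffAt ℝ 2 V u)
    (hW : ContDiffAt ℝ 2 W u) (v w : E) :
    fderiv ℝ (fderiv ℝ fun u' ↦ G (φ u') (V u') (W u')) u v w =
      G (φ u) (covDerivAlong G φ (fun u' ↦ covDerivAlong G φ V u' w) u v) (W u)
      + G (φ u) (covDerivAlong G φ V u w) (covDerivAlong G φ W u v)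
      + (G (φ u) (covDerivAlong G φ V u v) (covDerivAlong G φ W u w)
      + G (φ u) (V u) (covDerivAlong G φ (fun u' ↦ covDerivAlong G φ W u' w) u v)) := by
  have hGφ : ContDiffAt ℝ 2 (fun u' ↦ G (φ u')) u :=
    (hG.contDiffAt.comp u hφ).of_le (by norm_num)
  have hdGφ := hGφ.differentiableAt (by norm_num)
  have hdφ := hφ.differentiableAt (by norm_num)
  have hdV := hV.differentiableAt (by norm_num)
  have hdW := hW.differentiableAt (by norm_num)
  have hDV := differentiableAt_covDerivAlong hG hφ hV w
  have hDW := differentiableAt_covDerivAlong hG hφ hW w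
  have hfirst : (fun u' ↦ fderiv ℝ (fun u' ↦ G (φ u') (V u') (W u')) u' w) =ᶠ[𝓝 u]
      fun u' ↦ G (φ u') (covDerivAlong G φ V u' w) (W u')
        + G (φ u') (V u') (covDerivAlong G φ W u' w) := by
    filter_upwards [hφ.continuousAt.eventually hG.eventually, hφ.eventually (by decide),
      hV.eventually (by decide), hW.eventually (by decide)] with u' hG' hφ' hV' hW'
    exact fderiv_metric_apply hG' (hφ'.differentiableAt (by norm_num))
      (hV'.differentiableAt (by norm_num)) (hW'.differentiableAt (by norm_num)) w
  rw [← fderiv_fderiv_apply (differentiableAt_fderiv ((hGφ.clm_apply hV).clm_apply hW)),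
    hfirst.fderiv_eq, fderiv_fun_add ((hdGφ.clm_apply hDV).clm_apply hdW)
      ((hdGφ.clm_apply hdV).clm_apply hDW), add_apply,
    fderiv_metric_apply hG hdφ hDV hdW, fderiv_metric_apply hG hdφ hdV hDW]

theorem chartCurvature_skew [CompleteSpace F] (hG : IsChartMetricAt G y) (v w z z' : F) :
    G y (chartCurvature G y v w z) z' = - G y (chartCurvature G y v w z') z := by
  have hsecond (v w : F) := fderiv_fderiv_metric_apply (φ := id) (V := fun _ ↦ z) (W := fun _ ↦ z')
    (u := y) hG contDiffAt_id contDiffAt_const contDiffAt_const v w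
  have hcomm := fderiv_fderiv_comm (φ := fun y' ↦ G y' z z') (((hG.contDiffAt.clm_apply
    contDiffAt_const).clm_apply contDiffAt_const).of_le (by norm_num)) v w
  simp only [id] at hsecond
  rw [hsecond, hsecond] at hcomm
  rw [hG.apply_comm (chartCurvature G y v w z')]
  simp only [chartCurvature, map_sub, sub_apply]
  linarith

end ChartMetric

section ChartImmersion

variable {E F : Type*} [NormedAddCommGroup E] [NormedSpace ℝ E]
  [NormedAddCommGroup F] [NormedSpace ℝ F]

/-- `φ` is a `C³` isometric immersion near `u`, from the metric `g` to the metric `G`. -/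
structure IsChartIsometricAt (g : E → E →L[ℝ] E →L[ℝ] ℝ) (G : F → F →L[ℝ] F →L[ℝ] ℝ)
    (φ : E → F) (u : E) : Prop where
  source : IsChartMetricAt g u
  target : IsChartMetricAt G (φ u)
  contDiffAt : ContDiffAt ℝ 3 φ u
  eventually_isometric :
    ∀ᶠ u' in 𝓝 u, ∀ v w, G (φ u') (fderiv ℝ φ u' v) (fderiv ℝ φ u' w) = g u' v w

variable {g : E → E →L[ℝ] E →L[ℝ] ℝ} {G : F → F →L[ℝ] F →L[ℝ] ℝ} {φ : E → F} {u : E}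

namespace IsChartIsometricAt

theorem eventually [CompleteSpace E] [CompleteSpace F] (h : IsChartIsometricAt g G φ u) :
    ∀ᶠ u' in 𝓝 u, IsChartIsometricAt g G φ u' := by
  filter_upwards [h.source.eventually, h.contDiffAt.continuousAt.eventually h.target.eventually,
    h.contDiffAt.eventually (by decide), h.eventually_isometric.eventually_nhds]
    with u' hg hG hφ hiso
  exact ⟨hg, hG, hφ, hiso⟩

theorem contDiffAt_two (h : IsChartIsometricAt g G φ u) : ContDiffAt ℝ 2 φ u :=
  h.contDiffAt.of_le (by norm_num)

theorem differentiableAt (h : IsChartIsometricAt g G φ u) : DifferentiableAt ℝ φ u :=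
  h.contDiffAt.differentiableAt (by norm_num)

theorem contDiffAt_fderiv_apply (h : IsChartIsometricAt g G φ u) (w : E) :
    ContDiffAt ℝ 2 (fun u' ↦ fderiv ℝ φ u' w) u :=
  (h.contDiffAt.fderiv_right (by norm_num)).clm_apply contDiffAt_const

theorem differentiableAt_fderiv_apply (h : IsChartIsometricAt g G φ u) (w : E) :
    DifferentiableAt ℝ (fun u' ↦ fderiv ℝ φ u' w) u :=
  (h.contDiffAt_fderiv_apply w).differentiableAt (by norm_num)

theorem metric_fderiv (h : IsChartIsometricAt g G φ u) (v w : E) :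
    G (φ u) (fderiv ℝ φ u v) (fderiv ℝ φ u w) = g u v w :=
  h.eventually_isometric.self_of_nhds v w

theorem fderiv_source_metric (h : IsChartIsometricAt g G φ u) (v w z : E) :
    fderiv ℝ g u v w z =
      G (φ u) (covDerivAlong G φ (fun u' ↦ fderiv ℝ φ u' w) u v) (fderiv ℝ φ u z)
      + G (φ u) (covDerivAlong G φ (fun u' ↦ fderiv ℝ φ u' z) u v) (fderiv ℝ φ u w) := by
  have hpullback : (fun u' ↦ g u' w z) =ᶠ[𝓝 u]
      fun u' ↦ G (φ u') (fderiv ℝ φ u' w) (fderiv ℝ φ u' z) :=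
    h.eventually_isometric.mono fun _ hiso ↦ (hiso w z).symm
  rw [← fderiv_apply_apply h.source.differentiableAt, hpullback.fderiv_eq,
    fderiv_metric_apply h.target h.differentiableAt (h.differentiableAt_fderiv_apply w)
      (h.differentiableAt_fderiv_apply z), h.target.apply_comm (fderiv ℝ φ u w)]

theorem metric_covDerivAlong_fderiv (h : IsChartIsometricAt g G φ u) (v w z : E) :
    G (φ u) (covDerivAlong G φ (fun u' ↦ fderiv ℝ φ u' w) u v) (fderiv ℝ φ u z) =
      christoffelFirst g u v w z := by
  have htorsion := covDerivAlong_fderiv_comm h.target h.contDiffAt_two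
  simp only [christoffelFirst, smul_apply, sub_apply, smul_eq_mul, add_apply,
    ContinuousLinearMap.flip_apply]
  rw [h.fderiv_source_metric v w z, h.fderiv_source_metric w v z, h.fderiv_source_metric z v w,
    htorsion w v, htorsion z v, htorsion z w]
  ring

theorem covDerivAlong_fderiv_apply (h : IsChartIsometricAt g G φ u) {X : E → E}
    (hX : DifferentiableAt ℝ X u) (v : E) :
    covDerivAlong G φ (fun u' ↦ fderiv ℝ φ u' (X u')) u v =
      fderiv ℝ φ u (covDerivAlong g id X u v) + chartSecondFundamentalForm g G φ u v (X u) := by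
  rw [covDerivAlong, covDerivAlong, chartSecondFundamentalForm,
    ((differentiableAt_fderiv h.contDiffAt_two).hasFDerivAt.clm_apply hX.hasFDerivAt).fderiv]
  simp only [map_add, add_apply, ContinuousLinearMap.comp_apply, ContinuousLinearMap.flip_apply,
    fderiv_id, id, ContinuousLinearMap.id_apply]
  abel

theorem covDerivAlong_fderiv_const (h : IsChartIsometricAt g G φ u) (v w : E) :
    covDerivAlong G φ (fun u' ↦ fderiv ℝ φ u' w) u v =
      fderiv ℝ φ u (covDerivAlong g id (fun _ ↦ w) u v)
        + chartSecondFundamentalForm g G φ u v w :=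
  h.covDerivAlong_fderiv_apply (differentiableAt_const w) v

theorem metric_secondFundamentalForm_fderiv (h : IsChartIsometricAt g G φ u) (v w z : E) :
    G (φ u) (chartSecondFundamentalForm g G φ u v w) (fderiv ℝ φ u z) = 0 := by
  rw [← sub_eq_of_eq_add' (h.covDerivAlong_fderiv_const v w), map_sub, sub_apply,
    h.metric_covDerivAlong_fderiv, h.metric_fderiv, covDerivAlong_id_const,
    h.source.apply_christoffel, sub_self]

theorem secondFundamentalForm_comm (h : IsChartIsometricAt g G φ u) (v w : E) :
    chartSecondFundamentalForm g G φ u v w = chartSecondFundamentalForm g G φ u w v := by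
  rw [chartSecondFundamentalForm, chartSecondFundamentalForm, h.target.christoffel_comm,
    h.source.christoffel_comm, fderiv_fderiv_comm h.contDiffAt_two]

theorem metric_covDerivAlong_covDerivAlong [CompleteSpace E] [CompleteSpace F]
    (h : IsChartIsometricAt g G φ u) (v w z z' : E) :
    G (φ u) (covDerivAlong G φ (fun u₁ ↦ covDerivAlong G φ (fun u' ↦ fderiv ℝ φ u' z) u₁ w) u v)
        (fderiv ℝ φ u z') =
      g u (covDerivAlong g id (fun u₁ ↦ covDerivAlong g id (fun _ ↦ z) u₁ w) u v) z'
      - G (φ u) (chartSecondFundamentalForm g G φ u w z)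
          (chartSecondFundamentalForm g G φ u v z') := by
  have htarget := fderiv_metric_apply h.target h.differentiableAt
    (differentiableAt_covDerivAlong h.target h.contDiffAt (h.contDiffAt_fderiv_apply z) w)
    (h.differentiableAt_fderiv_apply z') v
  have hsource := fderiv_metric_apply (φ := id) h.source differentiableAt_id
    (differentiableAt_covDerivAlong (φ := id) (V := fun _ ↦ z) h.source contDiffAt_id
      contDiffAt_const w)
    (differentiableAt_const z') v
  have hagree : (fun u' ↦ G (φ u') (covDerivAlong G φ (fun u' ↦ fderiv ℝ φ u' z) u' w)
      (fderiv ℝ φ u' z')) =ᶠ[𝓝 u]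
      fun u' ↦ g (id u') (covDerivAlong g id (fun _ ↦ z) u' w) z' := by
    filter_upwards [h.eventually] with u' hu'
    rw [hu'.metric_covDerivAlong_fderiv, covDerivAlong_id_const, id, hu'.source.apply_christoffel]
  rw [hagree.fderiv_eq, hsource, h.covDerivAlong_fderiv_const w z,
    h.covDerivAlong_fderiv_const v z'] at htarget
  simp only [map_add, add_apply, h.metric_fderiv, h.metric_secondFundamentalForm_fderiv,
    h.target.apply_comm (fderiv ℝ φ u _) (chartSecondFundamentalForm g G φ u _ _), id] at htarget
  linarith

theorem gauss [CompleteSpace E] [CompleteSpace F] (h : IsChartIsometricAt g G φ u)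
    (v w z z' : E) :
    g u (chartCurvature g u v w z) z' =
      G (φ u) (chartCurvature G (φ u) (fderiv ℝ φ u v) (fderiv ℝ φ u w) (fderiv ℝ φ u z))
        (fderiv ℝ φ u z')
      + G (φ u) (chartSecondFundamentalForm g G φ u w z) (chartSecondFundamentalForm g G φ u v z')
      - G (φ u) (chartSecondFundamentalForm g G φ u v z)
          (chartSecondFundamentalForm g G φ u w z') := by
  rw [← covDerivAlong_commutator h.target h.contDiffAt (h.contDiffAt_fderiv_apply z) v w,
    map_sub, sub_apply, h.metric_covDerivAlong_covDerivAlong,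
    h.metric_covDerivAlong_covDerivAlong, chartCurvature, map_sub, sub_apply]
  ring

theorem metric_normalPart_fderiv (h : IsChartIsometricAt g G φ u) (y : F) (z : E) :
    G (φ u) (chartNormalPart g G φ u y) (fderiv ℝ φ u z) = 0 := by
  rw [chartNormalPart, map_sub, sub_apply, h.metric_fderiv,
    h.source.isInvertible.self_apply_inverse, ContinuousLinearMap.comp_apply, sub_self]

end IsChartIsometricAt

theorem metric_chartNormalPart (y : F) {η : F} (hη : ∀ z, G (φ u) (fderiv ℝ φ u z) η = 0) :
    G (φ u) (chartNormalPart g G φ u y) η = G (φ u) y η := by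
  rw [chartNormalPart, map_sub, sub_apply, hη, sub_zero]

/-- The tangential part of `∇̄_w ξ`; for a normal field `ξ` this is `-A_ξ w`. -/
def chartTangentialDeriv (g : E → E →L[ℝ] E →L[ℝ] ℝ) (G : F → F →L[ℝ] F →L[ℝ] ℝ)
    (φ : E → F) (ξ : E → F) (u w : E) : E :=
  (g u).inverse ((G (φ u) (covDerivAlong G φ ξ u w)) ∘L fderiv ℝ φ u)

theorem chartNormalDeriv_eq (ξ : E → F) (w : E) :
    chartNormalDeriv g G φ ξ u w =
      covDerivAlong G φ ξ u w - fderiv ℝ φ u (chartTangentialDeriv g G φ ξ u w) :=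
  rfl

namespace IsChartIsometricAt

theorem differentiableAt_tangentialDeriv [CompleteSpace E] [CompleteSpace F]
    (h : IsChartIsometricAt g G φ u) {ξ : E → F} (hξ : ContDiffAt ℝ 2 ξ u) (w : E) :
    DifferentiableAt ℝ (fun u' ↦ chartTangentialDeriv g G φ ξ u' w) u := by
  have hinverse : DifferentiableAt ℝ (fun u ↦ (g u).inverse) u :=
    ((h.source.isInvertible.contDiffAt_map_inverse (n := 1)).comp u
      (h.source.contDiffAt.of_le (by norm_num))).differentiableAt one_ne_zero
  have hGφ : DifferentiableAt ℝ (fun u ↦ G (φ u)) u :=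
    h.target.differentiableAt.comp u h.differentiableAt
  exact hinverse.clm_apply
    ((hGφ.clm_apply (differentiableAt_covDerivAlong h.target h.contDiffAt hξ w)).clm_comp
      (differentiableAt_fderiv h.contDiffAt_two))

theorem weingarten (h : IsChartIsometricAt g G φ u) {ξ : E → F} (hξ : DifferentiableAt ℝ ξ u)
    (hnormal : ∀ᶠ u' in 𝓝 u, ∀ z, G (φ u') (ξ u') (fderiv ℝ φ u' z) = 0) (w z : E) :
    g u (chartTangentialDeriv g G φ ξ u w) z =
      - G (φ u) (chartSecondFundamentalForm g G φ u w z) (ξ u) := by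
  have hvanish : (fun u' ↦ G (φ u') (ξ u') (fderiv ℝ φ u' z)) =ᶠ[𝓝 u] fun _ ↦ 0 :=
    hnormal.mono fun _ hu' ↦ hu' z
  have hcompat := fderiv_metric_apply h.target h.differentiableAt hξ
    (h.differentiableAt_fderiv_apply z) w
  rw [hvanish.fderiv_eq, h.covDerivAlong_fderiv_const, map_add, hnormal.self_of_nhds, zero_add,
    h.target.apply_comm (ξ u)] at hcompat
  simp only [fderiv_fun_const, Pi.zero_apply, zero_apply] at hcompat
  rw [chartTangentialDeriv, h.source.isInvertible.self_apply_inverse,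
    ContinuousLinearMap.comp_apply]
  linarith

theorem metric_normalDeriv_normalDeriv [CompleteSpace E] [CompleteSpace F]
    (h : IsChartIsometricAt g G φ u) {ξ : E → F} (hξ : ContDiffAt ℝ 2 ξ u) (v w : E)
    {η : F} (hη : ∀ z, G (φ u) (fderiv ℝ φ u z) η = 0) :
    G (φ u) (chartNormalDeriv g G φ (fun u' ↦ chartNormalDeriv g G φ ξ u' w) u v) η =
      G (φ u) (covDerivAlong G φ (fun u' ↦ covDerivAlong G φ ξ u' w) u v) η
      - G (φ u) (chartSecondFundamentalForm g G φ u v (chartTangentialDeriv g G φ ξ u w)) η := by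
  have hT := h.differentiableAt_tangentialDeriv hξ w
  rw [chartNormalDeriv, metric_chartNormalPart _ hη]
  simp only [chartNormalDeriv_eq]
  rw [covDerivAlong_sub (differentiableAt_covDerivAlong h.target h.contDiffAt hξ w)
      ((differentiableAt_fderiv h.contDiffAt_two).clm_apply hT),
    h.covDerivAlong_fderiv_apply hT, map_sub, map_add, sub_apply, add_apply, hη, zero_add]

theorem ricci [CompleteSpace E] [CompleteSpace F] (h : IsChartIsometricAt g G φ u) {ξ : E → F}
    (hξ : ContDiffAt ℝ 2 ξ u) (v w : E) {η : F} (hη : ∀ z, G (φ u) (fderiv ℝ φ u z) η = 0) :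
    G (φ u) (chartNormalCurvature g G φ ξ u v w) η =
      G (φ u) (chartCurvature G (φ u) (fderiv ℝ φ u v) (fderiv ℝ φ u w) (ξ u)) η
      - G (φ u) (chartSecondFundamentalForm g G φ u v (chartTangentialDeriv g G φ ξ u w)) η
      + G (φ u) (chartSecondFundamentalForm g G φ u w (chartTangentialDeriv g G φ ξ u v)) η := by
  rw [← covDerivAlong_commutator h.target h.contDiffAt hξ v w, chartNormalCurvature, map_sub,
    sub_apply, h.metric_normalDeriv_normalDeriv hξ v w hη,
    h.metric_normalDeriv_normalDeriv hξ w v hη, map_sub, sub_apply]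
  ring

theorem metric_normalCurvature_fderiv (h : IsChartIsometricAt g G φ u) (ξ : E → F) (v w z : E) :
    G (φ u) (chartNormalCurvature g G φ ξ u v w) (fderiv ℝ φ u z) = 0 := by
  rw [chartNormalCurvature, map_sub, sub_apply, chartNormalDeriv, chartNormalDeriv,
    h.metric_normalPart_fderiv, h.metric_normalPart_fderiv, sub_zero]

theorem normalCurvature_eq_zero [CompleteSpace E] [CompleteSpace F]
    (h : IsChartIsometricAt g G φ u) {ξ : E → F} (hξ : ContDiffAt ℝ 2 ξ u) {v w : E}
    (hcurv : ∀ η, (∀ z, G (φ u) (fderiv ℝ φ u z) η = 0) →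
      G (φ u) (chartCurvature G (φ u) (fderiv ℝ φ u v) (fderiv ℝ φ u w) (ξ u)) η = 0)
    (hcomm : chartSecondFundamentalForm g G φ u v (chartTangentialDeriv g G φ ξ u w) =
      chartSecondFundamentalForm g G φ u w (chartTangentialDeriv g G φ ξ u v)) :
    chartNormalCurvature g G φ ξ u v w = 0 := by
  refine h.target.ext fun y ↦ ?_
  have hdecomp : y = chartNormalPart g G φ u y
      + fderiv ℝ φ u ((g u).inverse ((G (φ u) y) ∘L fderiv ℝ φ u)) :=
    (sub_add_cancel _ _).symm
  have hnormal (z : E) : G (φ u) (fderiv ℝ φ u z) (chartNormalPart g G φ u y) = 0 := by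
    rw [h.target.apply_comm, h.metric_normalPart_fderiv]
  rw [map_zero, zero_apply, hdecomp, map_add, h.metric_normalCurvature_fderiv,
    h.ricci hξ v w hnormal, hcurv _ hnormal, hcomm]
  ring

end IsChartIsometricAt

end ChartImmersion

section CurvatureLike

variable {V : Type*}

/-- `T` has the linearity and the symmetries of a Riemann curvature tensor
`(x, y, z, w) ↦ ⟪R(x, y)z, w⟫`. Linearity in the other arguments follows. -/
structure IsCurvatureLike [AddCommGroup V] [Module ℝ V] (T : V → V → V → V → ℝ) : Prop where
  add_left : ∀ x x' y z w, T (x + x') y z w = T x y z w + T x' y z w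
  smul_left : ∀ (a : ℝ) (x y z w : V), T (a • x) y z w = a * T x y z w
  swap_left : ∀ x y z w, T x y z w = - T y x z w
  swap_right : ∀ x y z w, T x y z w = - T x y w z
  bianchi : ∀ x y z w, T x y z w + T y z x w + T z x y w = 0

theorem isCurvatureLike_constantCurvature [NormedAddCommGroup V] [InnerProductSpace ℝ V] (c : ℝ) :
    IsCurvatureLike fun x y z w : V ↦ c * (⟪y, z⟫_ℝ * ⟪x, w⟫_ℝ - ⟪x, z⟫_ℝ * ⟪y, w⟫_ℝ) where
  add_left x x' y z w := by rw [inner_add_left, inner_add_left]; ring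
  smul_left a x y z w := by rw [real_inner_smul_left, real_inner_smul_left]; ring
  swap_left x y z w := by ring
  swap_right x y z w := by ring
  bianchi x y z w := by rw [real_inner_comm x y, real_inner_comm y z, real_inner_comm z x]; ring

namespace IsCurvatureLike

variable [AddCommGroup V] [Module ℝ V] {T S : V → V → V → V → ℝ}

theorem sub (hT : IsCurvatureLike T) (hS : IsCurvatureLike S) :
    IsCurvatureLike fun x y z w ↦ T x y z w - S x y z w where
  add_left x x' y z w := by rw [hT.add_left, hS.add_left]; ring
  smul_left a x y z w := by rw [hT.smul_left, hS.smul_left]; ring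
  swap_left x y z w := by rw [hT.swap_left, hS.swap_left]; ring
  swap_right x y z w := by rw [hT.swap_right, hS.swap_right]; ring
  bianchi x y z w := by linarith [hT.bianchi x y z w, hS.bianchi x y z w]

theorem pair_comm (hT : IsCurvatureLike T) (x y z w : V) : T x y z w = T z w x y := by
  linarith [hT.bianchi x y z w, hT.bianchi y z w x, hT.bianchi z w x y, hT.bianchi w x y z,
    hT.swap_right y z x w, hT.swap_right z w y x, hT.swap_right w x z y, hT.swap_right x y w z,
    hT.swap_left z x y w, hT.swap_right x z y w, hT.swap_left w y z x, hT.swap_right y w z x]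

theorem add_second (hT : IsCurvatureLike T) (x y y' z w : V) :
    T x (y + y') z w = T x y z w + T x y' z w := by
  rw [hT.swap_left, hT.add_left, hT.swap_left x y, hT.swap_left x y', neg_add]

theorem add_third (hT : IsCurvatureLike T) (x y z z' w : V) :
    T x y (z + z') w = T x y z w + T x y z' w := by
  rw [hT.pair_comm, hT.add_left, hT.pair_comm z, hT.pair_comm z']

theorem add_fourth (hT : IsCurvatureLike T) (x y z w w' : V) :
    T x y z (w + w') = T x y z w + T x y z w' := by
  rw [hT.swap_right, hT.add_third, hT.swap_right x y z w, hT.swap_right x y z w', neg_add]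

theorem eq_zero_of_sectional_eq_zero (hT : IsCurvatureLike T) (hzero : ∀ x y, T x y y x = 0)
    (x y z w : V) : T x y z w = 0 := by
  have hmiddle (x y z : V) : T x y y z = 0 := by
    have hpolar := hzero (x + z) y
    rw [hT.add_left, hT.add_fourth, hT.add_fourth] at hpolar
    linarith [hzero x y, hzero z y, hT.pair_comm z y y x, hT.swap_left y x z y,
      hT.swap_right x y z y]
  have hswap_middle (x y z w : V) : T x y z w = - T x z y w := by
    have hpolar := hmiddle x (y + z) w
    rw [hT.add_second, hT.add_third, hT.add_third] at hpolar
    linarith [hmiddle x y w, hmiddle x z w]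
  linarith [hT.bianchi x y z w, hswap_middle y z x w, hT.swap_left y x z w,
    hT.swap_left z x y w, hswap_middle x y z w]

theorem apply_eq_zero_of_not_linearIndependent (hT : IsCurvatureLike T) {x y : V}
    (h : ¬ LinearIndependent ℝ ![x, y]) (z w : V) : T x y z w = 0 := by
  have hsmul (a : ℝ) (x : V) : T (a • x) x z w = 0 := by
    rw [hT.smul_left, mul_eq_zero]
    exact .inr (by linarith [hT.swap_left x x z w])
  obtain rfl | hx := eq_or_ne x 0
  · simpa only [zero_smul] using hsmul 0 y
  · simp only [LinearIndependent.pair_iff' hx, not_forall, not_not] at h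
    obtain ⟨a, rfl⟩ := h
    rw [hT.swap_left, hsmul, neg_zero]

end IsCurvatureLike

variable [NormedAddCommGroup V] [InnerProductSpace ℝ V]

theorem IsCurvatureLike.eq_of_sectional_eq {T : V → V → V → V → ℝ} (hT : IsCurvatureLike T) {c : ℝ}
    (h : ∀ x y, LinearIndependent ℝ ![x, y] →
      T x y y x = c * (‖x‖ ^ 2 * ‖y‖ ^ 2 - ⟪x, y⟫_ℝ ^ 2)) (x y z w : V) :
    T x y z w = c * (⟪y, z⟫_ℝ * ⟪x, w⟫_ℝ - ⟪x, z⟫_ℝ * ⟪y, w⟫_ℝ) := by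
  refine sub_eq_zero.mp ((hT.sub (isCurvatureLike_constantCurvature c)).eq_zero_of_sectional_eq_zero
    (fun x y ↦ ?_) x y z w)
  by_cases hxy : LinearIndependent ℝ ![x, y]
  · rw [h x y hxy, real_inner_self_eq_norm_sq, real_inner_self_eq_norm_sq, real_inner_comm x y]
    ring
  · exact (hT.sub (isCurvatureLike_constantCurvature c)).apply_eq_zero_of_not_linearIndependent hxy
      y x

theorem norm_sq_mul_norm_sq_sub_inner_sq_ne_zero {x y : V}
    (h : LinearIndependent ℝ ![x, y]) : ‖x‖ ^ 2 * ‖y‖ ^ 2 - ⟪x, y⟫_ℝ ^ 2 ≠ 0 := by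
  intro hzero
  have hx : x ≠ 0 := h.ne_zero 0
  have hy : y ≠ 0 := h.ne_zero 1
  have habs : ‖⟪x, y⟫_ℝ‖ = ‖x‖ * ‖y‖ := by
    rw [← sq_eq_sq₀ (by positivity) (by positivity), mul_pow, Real.norm_eq_abs, sq_abs]
    linarith
  obtain ⟨a, -, rfl⟩ := (norm_inner_eq_norm_iff hx hy).mp habs
  exact (LinearIndependent.pair_iff' hx).mp h a rfl

end CurvatureLike

section HilbertSchmidt

variable {T W : Type*} [NormedAddCommGroup T] [InnerProductSpace ℝ T]
  [NormedAddCommGroup W] [InnerProductSpace ℝ W] {ι : Type*} [Fintype ι]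

theorem sum_apply_self_eq_of_parseval {V : Type*} [AddCommGroup V] [Module ℝ V]
    {κ : Type*} [Fintype κ] {x : ι → T} (hx : ∀ y z, ∑ i, ⟪y, x i⟫_ℝ * ⟪x i, z⟫_ℝ = ⟪y, z⟫_ℝ)
    (g : OrthonormalBasis κ ℝ T) (C : T →ₗ[ℝ] T →ₗ[ℝ] V) :
    ∑ i, C (x i) (x i) = ∑ k, C (g k) (g k) := by
  classical
  calc ∑ i, C (x i) (x i)
      = ∑ i, ∑ k, ∑ l, (⟪g k, x i⟫_ℝ * ⟪x i, g l⟫_ℝ) • C (g k) (g l) := by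
        refine Finset.sum_congr rfl fun i _ ↦ ?_
        conv_lhs => rw [← g.sum_repr' (x i)]
        simp only [map_sum, map_smul, LinearMap.sum_apply, LinearMap.smul_apply, Finset.smul_sum,
          smul_smul]
        rw [Finset.sum_comm]
        simp only [real_inner_comm (x i), mul_comm]
    _ = ∑ k, ∑ l, ⟪g k, g l⟫_ℝ • C (g k) (g l) := by
        rw [Finset.sum_comm]
        refine Finset.sum_congr rfl fun k _ ↦ ?_
        rw [Finset.sum_comm]
        exact Finset.sum_congr rfl fun l _ ↦ by rw [← hx, Finset.sum_smul]
    _ = ∑ k, C (g k) (g k) := by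
        simp only [g.inner_eq_ite, ite_smul, one_smul, zero_smul, Finset.sum_ite_eq,
          Finset.mem_univ, if_true]

/-- The bilinear form `(v, w) ↦ ⟪v, w⟫ Λ`. -/
def innerForm (Λ : W) : T →ₗ[ℝ] T →ₗ[ℝ] W :=
  (innerₗ T).compr₂ (LinearMap.toSpanSingleton ℝ W Λ)

/-- The bilinear form `(v, w) ↦ ⟪e, v⟫ ⟪e, w⟫ Λ`. -/
def rankOneForm (e : T) (Λ : W) : T →ₗ[ℝ] T →ₗ[ℝ] W :=
  ((innerₗ T e).smulRight (innerₗ T e)).compr₂ (LinearMap.toSpanSingleton ℝ W Λ)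

/-- The bilinear form with matrix `diag(Λ, …, Λ, 2 Λ)` in any orthonormal basis whose last vector
is `e`. -/
def casoratiForm (e : T) (Λ : W) : T →ₗ[ℝ] T →ₗ[ℝ] W :=
  innerForm Λ + rankOneForm e Λ

theorem innerForm_apply (Λ : W) (v w : T) : innerForm Λ v w = ⟪v, w⟫_ℝ • Λ := rfl

theorem rankOneForm_apply (e : T) (Λ : W) (v w : T) :
    rankOneForm e Λ v w = (⟪e, v⟫_ℝ * ⟪e, w⟫_ℝ) • Λ := rfl

theorem casoratiForm_apply (e : T) (Λ : W) (v w : T) :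
    casoratiForm e Λ v w = (⟪v, w⟫_ℝ + ⟪e, v⟫_ℝ * ⟪e, w⟫_ℝ) • Λ :=
  (add_smul _ _ _).symm

/-- The bilinear maps attaining equality in the Casorati inequality. -/
def IsCasoratiIdeal (B : T →ₗ[ℝ] T →ₗ[ℝ] W) : Prop :=
  ∃ (e : T) (Λ : W), ‖e‖ = 1 ∧ B = casoratiForm e Λ

theorem IsCasoratiIdeal.apply_comm {B : T →ₗ[ℝ] T →ₗ[ℝ] W} (hB : IsCasoratiIdeal B)
    {v w v' w' : T} {ξ : W} (hv : ∀ z, ⟪v', z⟫_ℝ = -⟪B v z, ξ⟫_ℝ)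
    (hw : ∀ z, ⟪w', z⟫_ℝ = -⟪B w z, ξ⟫_ℝ) :
    B v w' = B w v' := by
  obtain ⟨e, Λ, -, rfl⟩ := hB
  simp only [casoratiForm_apply] at hv hw ⊢
  have hvw := hv w
  have hwv := hw v
  have hve := hv e
  have hwe := hw e
  simp only [real_inner_smul_left, real_inner_comm w v, real_inner_comm v w', real_inner_comm w v',
    real_inner_comm e] at hvw hwv hve hwe ⊢
  congr 1
  linear_combination hwv - hvw + ⟪e, v⟫_ℝ * hwe - ⟪e, w⟫_ℝ * hve

variable [FiniteDimensional ℝ T]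

/-- The trace of a vector-valued bilinear map with respect to the inner product; for the second
fundamental form this is the unnormalized mean curvature vector. -/
def metricTrace (B : T →ₗ[ℝ] T →ₗ[ℝ] W) : W :=
  ∑ i, B (stdOrthonormalBasis ℝ T i) (stdOrthonormalBasis ℝ T i)

/-- The squared Hilbert–Schmidt norm of a vector-valued bilinear map; for the second fundamental
form this is the Casorati curvature without its normalizing factor. -/
def hsNormSq (B : T →ₗ[ℝ] T →ₗ[ℝ] W) : ℝ :=
  ∑ i, ∑ j, ‖B (stdOrthonormalBasis ℝ T i) (stdOrthonormalBasis ℝ T j)‖ ^ 2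

variable {x : ι → T} (b : OrthonormalBasis ι ℝ T) (B : T →ₗ[ℝ] T →ₗ[ℝ] W)

theorem metricTrace_eq_sum_of_parseval
    (hx : ∀ y z, ∑ i, ⟪y, x i⟫_ℝ * ⟪x i, z⟫_ℝ = ⟪y, z⟫_ℝ) :
    metricTrace B = ∑ i, B (x i) (x i) :=
  (sum_apply_self_eq_of_parseval hx _ B).symm

theorem hsNormSq_eq_sum_of_parseval
    (hx : ∀ y z, ∑ i, ⟪y, x i⟫_ℝ * ⟪x i, z⟫_ℝ = ⟪y, z⟫_ℝ) :
    hsNormSq B = ∑ i, ∑ j, ‖B (x i) (x j)‖ ^ 2 := by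
  let g := stdOrthonormalBasis ℝ T
  have hright (v : T) : ∑ j, ‖B v (x j)‖ ^ 2 = ∑ l, ‖B v (g l)‖ ^ 2 := by
    simpa only [LinearMap.compl₁₂_apply, innerₗ_apply_apply, real_inner_self_eq_norm_sq] using
      sum_apply_self_eq_of_parseval hx g ((innerₗ W).compl₁₂ (B v) (B v))
  have hleft (w : T) : ∑ i, ‖B (x i) w‖ ^ 2 = ∑ k, ‖B (g k) w‖ ^ 2 := by
    simpa only [LinearMap.compl₁₂_apply, LinearMap.flip_apply, innerₗ_apply_apply,
      real_inner_self_eq_norm_sq] using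
      sum_apply_self_eq_of_parseval hx g ((innerₗ W).compl₁₂ (B.flip w) (B.flip w))
  simp only [hright]
  rw [Finset.sum_comm]
  simp only [hleft]
  rw [Finset.sum_comm, hsNormSq]

theorem metricTrace_eq_sum : metricTrace B = ∑ i, B (b i) (b i) :=
  metricTrace_eq_sum_of_parseval B b.sum_inner_mul_inner

theorem hsNormSq_eq_sum : hsNormSq B = ∑ i, ∑ j, ‖B (b i) (b j)‖ ^ 2 :=
  hsNormSq_eq_sum_of_parseval B b.sum_inner_mul_inner

theorem norm_metricTrace_sq_sub_hsNormSq [DecidableEq ι] :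
    ‖metricTrace B‖ ^ 2 - hsNormSq B =
      ∑ i, ∑ j ∈ {i}ᶜ, (⟪B (b i) (b i), B (b j) (b j)⟫_ℝ - ‖B (b i) (b j)‖ ^ 2) := by
  have hdiag (i) : ∑ j ∈ {i}ᶜ, (⟪B (b i) (b i), B (b j) (b j)⟫_ℝ - ‖B (b i) (b j)‖ ^ 2) =
      ∑ j, (⟪B (b i) (b i), B (b j) (b j)⟫_ℝ - ‖B (b i) (b j)‖ ^ 2) := by
    rw [Fintype.sum_eq_add_sum_compl i, real_inner_self_eq_norm_sq, sub_self, zero_add]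
  simp only [hdiag, Finset.sum_sub_distrib, ← inner_sum, ← sum_inner, metricTrace_eq_sum b,
    hsNormSq_eq_sum b, real_inner_self_eq_norm_sq]

theorem hsNormSq_nonneg : 0 ≤ hsNormSq B :=
  Finset.sum_nonneg fun _ _ ↦ Finset.sum_nonneg fun _ _ ↦ sq_nonneg _

theorem hsNormSq_eq_zero_iff {B : T →ₗ[ℝ] T →ₗ[ℝ] W} : hsNormSq B = 0 ↔ B = 0 := by
  refine ⟨fun h ↦ ?_, fun h ↦ by simp [hsNormSq, h]⟩
  simp only [hsNormSq, Finset.sum_eq_zero_iff_of_nonneg, Finset.sum_nonneg, sq_nonneg,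
    implies_true, Finset.mem_univ, forall_const, sq_eq_zero_iff, norm_eq_zero] at h
  exact (stdOrthonormalBasis ℝ T).toBasis.ext fun i ↦ (stdOrthonormalBasis ℝ T).toBasis.ext
    fun j ↦ by simpa using h i j

theorem exists_orthonormalBasis_apply_eq (hι : Module.finrank ℝ T = Fintype.card ι) (i : ι) {e : T}
    (he : ‖e‖ = 1) : ∃ b : OrthonormalBasis ι ℝ T, b i = e := by
  have horth : Orthonormal ℝ (({i} : Set ι).domRestrict fun _ ↦ e) :=
    orthonormal_subsingleton_iff.mpr fun _ ↦ he
  obtain ⟨b, hb⟩ := horth.exists_orthonormalBasis_extension_of_card_eq hι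
  exact ⟨b, hb i rfl⟩

theorem exists_orthonormalBasis_exists_apply_eq {e : T} (he : ‖e‖ = 1) :
    ∃ (b : OrthonormalBasis (Fin (Module.finrank ℝ T)) ℝ T) (i : _), b i = e := by
  have : Nontrivial T := ⟨e, 0, by rintro rfl; simp at he⟩
  let i₀ : Fin (Module.finrank ℝ T) := ⟨0, Module.finrank_pos⟩
  obtain ⟨b, hb⟩ := exists_orthonormalBasis_apply_eq (by simp) i₀ he
  exact ⟨b, i₀, hb⟩

theorem hsNormSq_sub_innerForm (Λ : W) :
    hsNormSq (B - innerForm Λ) =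
      hsNormSq B - 2 * ⟪metricTrace B, Λ⟫_ℝ + Module.finrank ℝ T * ‖Λ‖ ^ 2 := by
  let b := stdOrthonormalBasis ℝ T
  have hentry (i j) : ‖(B - innerForm Λ : T →ₗ[ℝ] T →ₗ[ℝ] W) (b i) (b j)‖ ^ 2 =
      ‖B (b i) (b j)‖ ^ 2 - (if i = j then 2 * ⟪B (b i) (b j), Λ⟫_ℝ else 0) +
        if i = j then ‖Λ‖ ^ 2 else 0 := by
    rw [LinearMap.sub_apply, LinearMap.sub_apply, innerForm_apply, b.inner_eq_ite]
    split_ifs <;> simp [norm_sub_sq_real]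
  simp only [hsNormSq_eq_sum b, metricTrace_eq_sum b, hentry, Finset.sum_add_distrib,
    Finset.sum_sub_distrib, Finset.sum_ite_eq, Finset.mem_univ, if_true, ← Finset.mul_sum,
    sum_inner, Finset.sum_const, Finset.card_univ, Fintype.card_fin, nsmul_eq_mul]

theorem hsNormSq_sub_rankOneForm {e : T} (he : ‖e‖ = 1) (Λ : W) :
    hsNormSq (B - rankOneForm e Λ) = hsNormSq B - 2 * ⟪B e e, Λ⟫_ℝ + ‖Λ‖ ^ 2 := by
  obtain ⟨b, i₀, hb⟩ := exists_orthonormalBasis_exists_apply_eq he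
  have hentry (i j) : ‖(B - rankOneForm e Λ) (b i) (b j)‖ ^ 2 =
      ‖B (b i) (b j)‖ ^ 2 -
          (if i₀ = i then if i₀ = j then 2 * ⟪B (b i) (b j), Λ⟫_ℝ else 0 else 0) +
        if i₀ = i then if i₀ = j then ‖Λ‖ ^ 2 else 0 else 0 := by
    rw [LinearMap.sub_apply, LinearMap.sub_apply, rankOneForm_apply, ← hb, b.inner_eq_ite,
      b.inner_eq_ite]
    split_ifs <;> simp [norm_sub_sq_real]
  simp only [hsNormSq_eq_sum b, hentry, Finset.sum_add_distrib, Finset.sum_sub_distrib,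
    Finset.sum_ite_irrel, Finset.sum_const_zero, Finset.sum_ite_eq, Finset.mem_univ, if_true, hb]

theorem metricTrace_casoratiForm {e : T} (he : ‖e‖ = 1) (Λ : W) :
    metricTrace (casoratiForm e Λ) = ((Module.finrank ℝ T : ℝ) + 1) • Λ := by
  have hnorm := (stdOrthonormalBasis ℝ T).sum_sq_inner_left e
  have hentry (i) (b := stdOrthonormalBasis ℝ T) :
      casoratiForm e Λ (b i) (b i) = (1 + ⟪e, b i⟫_ℝ ^ 2) • Λ := by
    rw [casoratiForm_apply, b.inner_eq_one, sq]
  rw [he, one_pow] at hnorm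
  simp only [metricTrace, hentry, ← Finset.sum_smul, Finset.sum_add_distrib, hnorm,
    Finset.sum_const, Finset.card_univ, Fintype.card_fin, nsmul_eq_mul, mul_one]

end HilbertSchmidt

section Hyperplane

variable {T W : Type*} [NormedAddCommGroup T] [InnerProductSpace ℝ T]
  [NormedAddCommGroup W] [InnerProductSpace ℝ W]

theorem coe_orthogonalProjectionOnto_orthogonal_span_singleton {e : T} (he : ‖e‖ = 1) (x : T) :
    ((ℝ ∙ e)ᗮ.orthogonalProjectionOnto x : T) = x - ⟪e, x⟫_ℝ • e := by
  rw [← Submodule.starProjection_apply, Submodule.starProjection_orthogonal_val,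
    Submodule.starProjection_unit_singleton ℝ he]

variable [FiniteDimensional ℝ T] {ι : Type*} [Fintype ι]
  (b : OrthonormalBasis ι ℝ T) (B : T →ₗ[ℝ] T →ₗ[ℝ] W)

theorem sum_inner_orthogonalProjectionOnto_mul (L : Submodule ℝ T) (y z : L) :
    ∑ i, ⟪y, L.orthogonalProjectionOnto (b i)⟫_ℝ * ⟪L.orthogonalProjectionOnto (b i), z⟫_ℝ =
      ⟪y, z⟫_ℝ := by
  simp only [Submodule.inner_orthogonalProjectionOnto_eq_of_mem_left,
    Submodule.inner_orthogonalProjectionOnto_eq_of_mem_right]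
  exact b.sum_inner_mul_inner _ _

theorem metricTrace_domRestrict_orthogonal {e : T} (he : ‖e‖ = 1) :
    metricTrace (B.domRestrict₁₂ (ℝ ∙ e)ᗮ (ℝ ∙ e)ᗮ) = metricTrace B - B e e := by
  obtain ⟨b, i₀, rfl⟩ := exists_orthonormalBasis_exists_apply_eq he
  have hentry (i) : B (b i - ⟪b i₀, b i⟫_ℝ • b i₀) (b i - ⟪b i₀, b i⟫_ℝ • b i₀) =
      B (b i) (b i) - if i₀ = i then B (b i) (b i) else 0 := by
    rw [b.inner_eq_ite]
    split_ifs with hi <;> simp [hi]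
  rw [metricTrace_eq_sum_of_parseval _ (sum_inner_orthogonalProjectionOnto_mul b _)]
  simp only [LinearMap.domRestrict₁₂_apply, hentry, Finset.sum_sub_distrib, Finset.sum_ite_eq,
    coe_orthogonalProjectionOnto_orthogonal_span_singleton he, Finset.mem_univ, if_true,
    metricTrace_eq_sum b]

theorem hsNormSq_domRestrict_orthogonal {e : T} (he : ‖e‖ = 1) :
    hsNormSq (B.domRestrict₁₂ (ℝ ∙ e)ᗮ (ℝ ∙ e)ᗮ) =
      ∑ i, ∑ j, ‖B (b i - ⟪e, b i⟫_ℝ • e) (b j - ⟪e, b j⟫_ℝ • e)‖ ^ 2 := by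
  simp only [hsNormSq_eq_sum_of_parseval _ (sum_inner_orthogonalProjectionOnto_mul b _),
    LinearMap.domRestrict₁₂_apply, coe_orthogonalProjectionOnto_orthogonal_span_singleton he]

theorem finrank_orthogonal_span_singleton_add_one {e : T} (he : ‖e‖ = 1) :
    Module.finrank ℝ (ℝ ∙ e)ᗮ + 1 = Module.finrank ℝ T := by
  rw [← Submodule.finrank_add_finrank_orthogonal (ℝ ∙ e), add_comm,
    finrank_span_singleton (norm_ne_zero_iff.mp (by simp [he]))]

theorem exists_eq_orthogonal_span_singleton {L : Submodule ℝ T}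
    (hL : Module.finrank ℝ L + 1 = Module.finrank ℝ T) : ∃ e : T, ‖e‖ = 1 ∧ L = (ℝ ∙ e)ᗮ := by
  have hLperp : Module.finrank ℝ Lᗮ = 1 := by
    have := L.finrank_add_finrank_orthogonal
    omega
  have : Nontrivial Lᗮ := Module.nontrivial_of_finrank_pos (R := ℝ) (by omega)
  obtain ⟨e, he⟩ := exists_norm_eq Lᗮ zero_le_one
  refine ⟨e, he, Submodule.eq_of_le_of_finrank_eq ?_ ?_⟩
  · rw [Submodule.le_orthogonal_iff_le_orthogonal, Submodule.span_singleton_le_iff_mem]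
    exact e.2
  · have := finrank_orthogonal_span_singleton_add_one (e := (e : T)) he
    omega

theorem exists_forall_hsNormSq_domRestrict_orthogonal_le [Nontrivial T] :
    ∃ e₀ : T, ‖e₀‖ = 1 ∧ ∀ e : T, ‖e‖ = 1 →
      hsNormSq (B.domRestrict₁₂ (ℝ ∙ e₀)ᗮ (ℝ ∙ e₀)ᗮ) ≤
        hsNormSq (B.domRestrict₁₂ (ℝ ∙ e)ᗮ (ℝ ∙ e)ᗮ) := by
  let b := stdOrthonormalBasis ℝ T
  have hcont : Continuous fun e ↦
      ∑ i, ∑ j, ‖B (b i - ⟪e, b i⟫_ℝ • e) (b j - ⟪e, b j⟫_ℝ • e)‖ ^ 2 := by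
    simp only [← B.toContinuousBilinearMap_apply]
    fun_prop
  obtain ⟨e₀, he₀, hmin⟩ := (isCompact_sphere (0 : T) 1).exists_isMinOn
    (NormedSpace.sphere_nonempty.mpr zero_le_one) hcont.continuousOn
  rw [mem_sphere_zero_iff_norm] at he₀
  refine ⟨e₀, he₀, fun e he ↦ ?_⟩
  rw [hsNormSq_domRestrict_orthogonal b B he₀, hsNormSq_domRestrict_orthogonal b B he]
  exact hmin (mem_sphere_zero_iff_norm.mpr he)

theorem hsNormSq_add_hsNormSq_domRestrict {e : T} (he : ‖e‖ = 1) {Λ : W}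
    (hΛ : metricTrace B = ((Module.finrank ℝ T : ℝ) + 1) • Λ) :
    hsNormSq B + hsNormSq (B.domRestrict₁₂ (ℝ ∙ e)ᗮ (ℝ ∙ e)ᗮ) =
      2 / ((Module.finrank ℝ T : ℝ) + 1) * ‖metricTrace B‖ ^ 2 +
        hsNormSq (B - casoratiForm e Λ) +
        hsNormSq ((B - casoratiForm e Λ).domRestrict₁₂ (ℝ ∙ e)ᗮ (ℝ ∙ e)ᗮ) := by
  have hrestrict : (B - casoratiForm e Λ).domRestrict₁₂ (ℝ ∙ e)ᗮ (ℝ ∙ e)ᗮ =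
      B.domRestrict₁₂ (ℝ ∙ e)ᗮ (ℝ ∙ e)ᗮ - innerForm Λ := by
    refine LinearMap.ext₂ fun v w ↦ ?_
    have hv : ⟪e, (v : T)⟫_ℝ = 0 := Submodule.mem_orthogonal_singleton_iff_inner_right.mp v.2
    change B v w - casoratiForm e Λ v w = B v w - ⟪(v : T), w⟫_ℝ • Λ
    rw [casoratiForm_apply, hv, zero_mul, add_zero]
  have hdim : (Module.finrank ℝ (ℝ ∙ e)ᗮ : ℝ) + 1 = Module.finrank ℝ T := by
    exact_mod_cast finrank_orthogonal_span_singleton_add_one he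
  rw [hrestrict, hsNormSq_sub_innerForm, metricTrace_domRestrict_orthogonal B he, casoratiForm,
    ← sub_sub, hsNormSq_sub_rankOneForm _ he, hsNormSq_sub_innerForm]
  simp only [LinearMap.sub_apply, innerForm_apply, real_inner_self_eq_norm_sq, he, inner_sub_left,
    hΛ, real_inner_smul_left, norm_smul, ← hdim, one_pow, one_smul, mul_pow, Real.norm_eq_abs,
    sq_abs]
  field_simp
  ring

/-- The set whose infimum enters the normalized `δ`-Casorati curvature. -/
def hyperplaneCasoratiCurvatures (n : ℕ) (B : T →ₗ[ℝ] T →ₗ[ℝ] W) : Set ℝ :=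
  {c | ∃ L : Submodule ℝ T, Module.finrank ℝ L + 1 = n ∧
    c = 1 / (Module.finrank ℝ L : ℝ) * hsNormSq (B.domRestrict₁₂ L L)}

variable {B} {n : ℕ}

theorem mem_hyperplaneCasoratiCurvatures_iff (hT : Module.finrank ℝ T = n) {c : ℝ} :
    c ∈ hyperplaneCasoratiCurvatures n B ↔ ∃ e : T, ‖e‖ = 1 ∧
      c = 1 / ((n : ℝ) - 1) * hsNormSq (B.domRestrict₁₂ (ℝ ∙ e)ᗮ (ℝ ∙ e)ᗮ) := by
  have hcast {L : Submodule ℝ T} (hL : Module.finrank ℝ L + 1 = n) :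
      (Module.finrank ℝ L : ℝ) = n - 1 := by
    rw [← hL, Nat.cast_add_one, add_sub_cancel_right]
  constructor
  · rintro ⟨L, hL, rfl⟩
    obtain ⟨e, he, rfl⟩ := exists_eq_orthogonal_span_singleton (hL.trans hT.symm)
    exact ⟨e, he, by rw [hcast hL]⟩
  · rintro ⟨e, he, rfl⟩
    have hL := (finrank_orthogonal_span_singleton_add_one he).trans hT
    exact ⟨(ℝ ∙ e)ᗮ, hL, by rw [hcast hL]⟩

variable (B) in
theorem exists_isLeast_hyperplaneCasoratiCurvatures (hT : Module.finrank ℝ T = n) (hn : 1 ≤ n) :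
    ∃ e : T, ‖e‖ = 1 ∧ IsLeast (hyperplaneCasoratiCurvatures n B)
      (1 / ((n : ℝ) - 1) * hsNormSq (B.domRestrict₁₂ (ℝ ∙ e)ᗮ (ℝ ∙ e)ᗮ)) := by
  have : Nontrivial T := Module.nontrivial_of_finrank_pos (R := ℝ) (by omega)
  have hn' : (1 : ℝ) ≤ n := by exact_mod_cast hn
  obtain ⟨e₀, he₀, hmin⟩ := exists_forall_hsNormSq_domRestrict_orthogonal_le B
  refine ⟨e₀, he₀, (mem_hyperplaneCasoratiCurvatures_iff hT).mpr ⟨e₀, he₀, rfl⟩, ?_⟩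
  rintro c hc
  obtain ⟨e, he, rfl⟩ := (mem_hyperplaneCasoratiCurvatures_iff hT).mp hc
  exact mul_le_mul_of_nonneg_left (hmin e he) (one_div_nonneg.mpr (sub_nonneg.mpr hn'))

variable (B) in
theorem casorati_defect_eq (hT : Module.finrank ℝ T = n) (hn : 2 ≤ n) {e : T} (he : ‖e‖ = 1)
    {Λ : W} (hΛ : metricTrace B = ((n : ℝ) + 1) • Λ) :
    1 / 2 * (1 / n * hsNormSq B) + ((n : ℝ) + 1) / (2 * n) *
          (1 / ((n : ℝ) - 1) * hsNormSq (B.domRestrict₁₂ (ℝ ∙ e)ᗮ (ℝ ∙ e)ᗮ)) -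
        (‖metricTrace B‖ ^ 2 - hsNormSq B) / (n * ((n : ℝ) - 1)) =
      ((n : ℝ) + 1) / (2 * n * ((n : ℝ) - 1)) * (hsNormSq (B - casoratiForm e Λ) +
        hsNormSq ((B - casoratiForm e Λ).domRestrict₁₂ (ℝ ∙ e)ᗮ (ℝ ∙ e)ᗮ)) := by
  have hidentity := hsNormSq_add_hsNormSq_domRestrict B he (by rwa [hT])
  have hn' : (2 : ℝ) ≤ n := by exact_mod_cast hn
  have hn₁ : (n : ℝ) - 1 ≠ 0 := by linarith
  rw [hT] at hidentity
  rw [eq_sub_of_add_eq' hidentity]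
  field_simp
  ring

variable (B) in
theorem casorati_inequality (hT : Module.finrank ℝ T = n) (hn : 2 ≤ n) :
    (‖metricTrace B‖ ^ 2 - hsNormSq B) / (n * ((n : ℝ) - 1)) ≤
      1 / 2 * (1 / n * hsNormSq B) +
        ((n : ℝ) + 1) / (2 * n) * sInf (hyperplaneCasoratiCurvatures n B) := by
  have hn' : (2 : ℝ) ≤ n := by exact_mod_cast hn
  obtain ⟨e, he, hleast⟩ := exists_isLeast_hyperplaneCasoratiCurvatures B hT (by omega)
  have hdefect := casorati_defect_eq B hT hn he (smul_inv_smul₀ (by positivity) _).symm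
  rw [hleast.csInf_eq, ← sub_nonneg, hdefect]
  exact mul_nonneg (div_nonneg (by linarith) (mul_nonneg (by linarith) (by linarith)))
    (add_nonneg (hsNormSq_nonneg _) (hsNormSq_nonneg _))

theorem casorati_equality_iff (hT : Module.finrank ℝ T = n) (hn : 2 ≤ n) :
    (‖metricTrace B‖ ^ 2 - hsNormSq B) / (n * ((n : ℝ) - 1)) =
      1 / 2 * (1 / n * hsNormSq B) +
        ((n : ℝ) + 1) / (2 * n) * sInf (hyperplaneCasoratiCurvatures n B) ↔
      IsCasoratiIdeal B := by
  have hn' : (2 : ℝ) ≤ n := by exact_mod_cast hn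
  have hn₁ : (0 : ℝ) < n - 1 := by linarith
  obtain ⟨e₀, he₀, hleast⟩ := exists_isLeast_hyperplaneCasoratiCurvatures B hT (by omega)
  constructor
  · intro heq
    have hdefect := casorati_defect_eq B hT hn he₀ (smul_inv_smul₀ (by positivity) _).symm
    rw [← hleast.csInf_eq, ← heq, sub_self, eq_comm, mul_eq_zero_iff_left (by positivity),
      add_eq_zero_iff_of_nonneg (hsNormSq_nonneg _) (hsNormSq_nonneg _)] at hdefect
    exact ⟨e₀, _, he₀, sub_eq_zero.mp (hsNormSq_eq_zero_iff.mp hdefect.1)⟩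
  · rintro ⟨e, Λ, he, rfl⟩
    refine (casorati_inequality _ hT hn).antisymm ?_
    have hdefect := casorati_defect_eq (casoratiForm e Λ) hT hn he
      (by rw [metricTrace_casoratiForm he, hT])
    have hvanish : hsNormSq ((0 : T →ₗ[ℝ] T →ₗ[ℝ] W).domRestrict₁₂ (ℝ ∙ e)ᗮ (ℝ ∙ e)ᗮ) = 0 :=
      hsNormSq_eq_zero_iff.mpr rfl
    rw [sub_self, hvanish, hsNormSq_eq_zero_iff.mpr rfl, add_zero, mul_zero] at hdefect
    rw [← sub_eq_zero.mp hdefect]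
    gcongr
    exact hleast.csInf_eq.trans_le
      (hleast.2 ((mem_hyperplaneCasoratiCurvatures_iff hT).mpr ⟨e, he, rfl⟩))

end Hyperplane

section ExtChart

variable {E H M : Type*} [NormedAddCommGroup E] [NormedSpace ℝ E] [TopologicalSpace H]
  {I : ModelWithCorners ℝ E H} [TopologicalSpace M] [ChartedSpace H M]
  {E' H' N : Type*} [NormedAddCommGroup E'] [NormedSpace ℝ E'] [TopologicalSpace H']
  {I' : ModelWithCorners ℝ E' H'} [TopologicalSpace N] [ChartedSpace H' N]
  {f : M → N}

variable (I I') in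
theorem writtenInExtChartAt_extChartAt_self (f : M → N) (x : M) :
    writtenInExtChartAt I I' x f (extChartAt I x x) = extChartAt I' (f x) (f x) := by
  simp [writtenInExtChartAt]

variable (I I') in
theorem eventually_extChartAt_symm_writtenInExtChartAt {x : M} (hf : ContinuousAt f x) :
    ∀ᶠ u in 𝓝 (extChartAt I x x), f ((extChartAt I x).symm u) ∈ (extChartAt I' (f x)).source ∧
      (extChartAt I' (f x)).symm (writtenInExtChartAt I I' x f u) =
        f ((extChartAt I x).symm u) := by
  have hcont : ContinuousAt (f ∘ (extChartAt I x).symm) (extChartAt I x x) :=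
    ContinuousAt.comp (by rwa [extChartAt_to_inv]) (continuousAt_extChartAt_symm x)
  have hsource := hcont.preimage_mem_nhds (t := (extChartAt I' (f x)).source)
    (by simpa using extChartAt_source_mem_nhds (I := I') (f x))
  filter_upwards [hsource] with u hu
  exact ⟨hu, (extChartAt I' (f x)).left_inv hu⟩

variable [I.Boundaryless]

theorem mdifferentiableAt_extChartAt_symm [IsManifold I 1 M] {x : M} {u : E}
    (hu : u ∈ (extChartAt I x).target) :
    MDifferentiableAt 𝓘(ℝ, E) I (extChartAt I x).symm u := by
  have h := mdifferentiableWithinAt_extChartAt_symm hu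
  rwa [I.range_eq_univ, mdifferentiableWithinAt_univ] at h

theorem mfderiv_extChartAt_symm_self [IsManifold I 1 M] (x : M) :
    mfderiv 𝓘(ℝ, E) I (extChartAt I x).symm (extChartAt I x x) = ContinuousLinearMap.id ℝ E := by
  rw [← mfderivWithin_univ, ← I.range_eq_univ]
  exact mfderivWithin_range_extChartAt_symm

theorem mfderiv_extChartAt_symm_apply [IsManifold I 1 M] {x : M} {u : E}
    (hu : u ∈ (extChartAt I x).target) (v : E) :
    mfderiv 𝓘(ℝ, E) I (extChartAt I x).symm u v =
      (trivializationAt E (TangentSpace I) x).symm ((extChartAt I x).symm u) v := by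
  have hsource : (extChartAt I x).symm u ∈ (chartAt H x).source := by
    simpa using (extChartAt I x).map_target hu
  have hsymmL := TangentBundle.symmL_trivializationAt (I := I) (𝕜 := ℝ) hsource
  rw [I.range_eq_univ, mfderivWithin_univ, (extChartAt I x).right_inv hu] at hsymmL
  rw [← hsymmL]
  exact Trivialization.symmL_apply _ hsource v

theorem fderiv_writtenInExtChartAt {x : M} (hf : MDifferentiableAt I I' f x) :
    fderiv ℝ (writtenInExtChartAt I I' x f) (extChartAt I x x) = mfderiv I I' f x := by
  let D : E →L[ℝ] E' := mfderiv I I' f x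
  have h : HasFDerivWithinAt (writtenInExtChartAt I I' x f) D (Set.range I) (extChartAt I x x) :=
    hf.hasMFDerivAt.2
  rw [I.range_eq_univ, hasFDerivWithinAt_univ] at h
  exact h.fderiv

theorem eventually_mfderiv_extChartAt_symm_fderiv [I'.Boundaryless] [IsManifold I 1 M]
    [IsManifold I' 1 N] (hf : MDifferentiable I I' f) (x : M) :
    ∀ᶠ u in 𝓝 (extChartAt I x x), ∀ v,
      (mfderiv 𝓘(ℝ, E') I' (extChartAt I' (f x)).symm (writtenInExtChartAt I I' x f u)
        (fderiv ℝ (writtenInExtChartAt I I' x f) u v) : E') =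
      mfderiv I I' f ((extChartAt I x).symm u)
        (mfderiv 𝓘(ℝ, E) I (extChartAt I x).symm u v) := by
  filter_upwards [extChartAt_target_mem_nhds (I := I) x,
    (eventually_extChartAt_symm_writtenInExtChartAt I I'
      (hf x).continuousAt).eventually_nhds] with u hu hlift v
  have hsymm := mdifferentiableAt_extChartAt_symm hu
  have hchart : MDifferentiableAt I' 𝓘(ℝ, E') (extChartAt I' (f x)) (f ((extChartAt I x).symm u)) :=
    mdifferentiableAt_extChartAt (by simpa using hlift.self_of_nhds.1)
  have hφ : MDifferentiableAt 𝓘(ℝ, E) 𝓘(ℝ, E') (writtenInExtChartAt I I' x f) u :=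
    hchart.comp u ((hf _).comp u hsymm)
  have hsymm' := mdifferentiableAt_extChartAt_symm
    ((extChartAt I' (f x)).map_source hlift.self_of_nhds.1)
  have hderiv : mfderiv 𝓘(ℝ, E) I'
      ((extChartAt I' (f x)).symm ∘ writtenInExtChartAt I I' x f) u =
        mfderiv 𝓘(ℝ, E) I' (f ∘ (extChartAt I x).symm) u :=
    Filter.EventuallyEq.mfderiv_eq (hlift.mono fun _ h ↦ h.2)
  rw [mfderiv_comp u hsymm' hφ, mfderiv_comp u (hf _) hsymm, mfderiv_eq_fderiv] at hderiv
  exact congrArg (fun A : E →L[ℝ] E' ↦ A v) hderiv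

end ExtChart

theorem isInvertible_of_apply_self_ne_zero {F : Type*} [NormedAddCommGroup F] [NormedSpace ℝ F]
    [FiniteDimensional ℝ F] {A : F →L[ℝ] F →L[ℝ] ℝ} (hA : ∀ v ≠ 0, A v v ≠ 0) :
    A.IsInvertible := by
  have hinj : Function.Injective A.toLinearMap :=
    (injective_iff_map_eq_zero _).mpr fun v (hv : A v = 0) ↦ by
      by_contra hne
      exact hA v hne (by rw [hv, zero_apply])
  have hdim : Module.finrank ℝ F = Module.finrank ℝ (F →L[ℝ] ℝ) := by
    rw [← (LinearMap.toContinuousLinearMap (𝕜 := ℝ) (E := F) (F' := ℝ)).finrank_eq]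
    exact Subspace.dual_finrank_eq.symm
  exact ⟨(LinearEquiv.ofInjectiveOfFinrankEq _ hinj hdim).toContinuousLinearEquiv, rfl⟩

section RiemannianManifold

variable (m : ℕ) {M : Type*} [TopologicalSpace M] [ChartedSpace (EuclideanSpace ℝ (Fin m)) M]
  [RiemannianBundle (fun x : M ↦ TangentSpace (𝓡 m) x)]

/-- The inner product of the tangent space at `y`, as a function on the model space: vectors
expressed this way do not depend on `y`, so the base point can be rewritten. -/
def tangentInner (y : M) (a b : EuclideanSpace ℝ (Fin m)) : ℝ :=
  inner ℝ (E := TangentSpace (𝓡 m) y) a b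

theorem chartMetric_apply (x : M) (u v w : EuclideanSpace ℝ (Fin m)) :
    chartMetric m x u v w = tangentInner m ((extChartAt (𝓡 m) x).symm u)
      (mfderiv 𝓘(ℝ, EuclideanSpace ℝ (Fin m)) (𝓡 m) (extChartAt (𝓡 m) x).symm u v)
      (mfderiv 𝓘(ℝ, EuclideanSpace ℝ (Fin m)) (𝓡 m) (extChartAt (𝓡 m) x).symm u w) :=
  rfl

theorem chartMetric_comm (x : M) (u v w : EuclideanSpace ℝ (Fin m)) :
    chartMetric m x u v w = chartMetric m x u w v :=
  real_inner_comm (F := TangentSpace (𝓡 m) ((extChartAt (𝓡 m) x).symm u)) _ _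

variable [IsManifold (𝓡 m) ∞ M]

theorem chartMetric_self (x : M) (v w : TangentSpace (𝓡 m) x) :
    chartMetric m x (extChartAt (𝓡 m) x x) v w = ⟪v, w⟫_ℝ := by
  refine (chartMetric_apply m x _ v w).trans ?_
  rw [mfderiv_extChartAt_symm_self, extChartAt_to_inv]
  rfl

variable [IsContMDiffRiemannianBundle (𝓡 m) ∞ (EuclideanSpace ℝ (Fin m))
  (fun x : M ↦ TangentSpace (𝓡 m) x)]

theorem contDiffAt_chartMetric (x : M) :
    ContDiffAt ℝ ∞ (chartMetric m x) (extChartAt (𝓡 m) x x) := by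
  obtain ⟨g, hg, hinner⟩ := IsContMDiffRiemannianBundle.exists_contMDiff (IB := 𝓡 m) (n := ∞)
    (F := EuclideanSpace ℝ (Fin m)) (E := fun x : M ↦ TangentSpace (𝓡 m) x)
  have hcoord := (contMDiffAt_hom_bundle _).mp (hg.contMDiffAt (x := x)) |>.2
  rw [← extChartAt_to_inv (I := 𝓡 m) x] at hcoord
  have hsymm : ContMDiffAt 𝓘(ℝ, EuclideanSpace ℝ (Fin m)) (𝓡 m) ∞ (extChartAt (𝓡 m) x).symm
      (extChartAt (𝓡 m) x x) :=
    (contMDiffOn_extChartAt_symm x).contMDiffAt (extChartAt_target_mem_nhds x)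
  refine (ContMDiffAt.comp _ hcoord hsymm).contDiffAt.congr_of_eventuallyEq ?_
  filter_upwards [extChartAt_target_mem_nhds (I := 𝓡 m) x] with u hu
  have hbase : (extChartAt (𝓡 m) x).symm u ∈ (trivializationAt (EuclideanSpace ℝ (Fin m))
      (fun x : M ↦ TangentSpace (𝓡 m) x) x).baseSet := by
    simpa using (extChartAt (𝓡 m) x).map_target hu
  ext v w
  rw [extChartAt_to_inv, Function.comp_apply,
    inCoordinates_apply_eq₂ hbase hbase (Set.mem_univ _), chartMetric_apply,
    mfderiv_extChartAt_symm_apply hu, mfderiv_extChartAt_symm_apply hu]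
  refine (hinner _ _ _).trans ?_
  simp only [Trivial.fiberBundle_trivializationAt', Trivial.linearMapAt_trivialization]
  rfl

theorem isChartMetricAt_chartMetric (x : M) :
    IsChartMetricAt (chartMetric m x) (extChartAt (𝓡 m) x x) where
  contDiffAt := (contDiffAt_chartMetric m x).of_le ENat.LEInfty.out
  eventually_comm := .of_forall (chartMetric_comm m x)
  isInvertible := isInvertible_of_apply_self_ne_zero fun v hv h ↦
    hv (inner_self_eq_zero (𝕜 := ℝ) (E := TangentSpace (𝓡 m) x) |>.mp
      ((chartMetric_self m x v v).symm.trans h))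

theorem isCurvatureLike_inner_curvatureTensor (x : M) :
    IsCurvatureLike fun v w z z' : TangentSpace (𝓡 m) x ↦ ⟪curvatureTensor m x v w z, z'⟫_ℝ where
  add_left v v' w z z' := by
    rw [← inner_add_left]
    exact congrArg (⟪·, z'⟫_ℝ) (chartCurvature_add_left (isChartMetricAt_chartMetric m x) v v' w z)
  smul_left a v w z z' := by
    rw [← real_inner_smul_left]
    exact congrArg (⟪·, z'⟫_ℝ) (chartCurvature_smul_left (isChartMetricAt_chartMetric m x) a v w z)
  swap_left v w z z' := by
    rw [← inner_neg_left]
    exact congrArg (⟪·, z'⟫_ℝ) (chartCurvature_swap _ _ v w z)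
  swap_right v w z z' := by
    rw [← chartMetric_self, ← chartMetric_self]
    exact chartCurvature_skew (isChartMetricAt_chartMetric m x) v w z z'
  bianchi v w z z' := by
    rw [← inner_add_left, ← inner_add_left, ← inner_zero_left (𝕜 := ℝ) z']
    exact congrArg (⟪·, z'⟫_ℝ) (chartCurvature_bianchi (isChartMetricAt_chartMetric m x) v w z)

/-- All sectional curvatures at the point `x` are equal to `c`. -/
def HasConstantSectionalCurvatureAt (x : M) (c : ℝ) : Prop :=
  ∀ v w : TangentSpace (𝓡 m) x, LinearIndependent ℝ ![v, w] → sectionalCurvature m x v w = c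

variable {m} in
theorem HasConstantSectionalCurvatureAt.inner_curvatureTensor {x : M} {c : ℝ}
    (h : HasConstantSectionalCurvatureAt m x c) (v w z z' : TangentSpace (𝓡 m) x) :
    ⟪curvatureTensor m x v w z, z'⟫_ℝ =
      c * (⟪w, z⟫_ℝ * ⟪v, z'⟫_ℝ - ⟪v, z⟫_ℝ * ⟪w, z'⟫_ℝ) :=
  (isCurvatureLike_inner_curvatureTensor m x).eq_of_sectional_eq (fun v w hvw ↦
    (div_eq_iff (norm_sq_mul_norm_sq_sub_inner_sq_ne_zero hvw)).mp (h v w hvw)) v w z z'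

variable {m} in
theorem HasConstantSectionalCurvatureAt.inner_curvatureTensor_eq_zero {x : M} {c : ℝ}
    (h : HasConstantSectionalCurvatureAt m x c) {v w η : TangentSpace (𝓡 m) x}
    (hv : ⟪v, η⟫_ℝ = 0) (hw : ⟪w, η⟫_ℝ = 0) (z : TangentSpace (𝓡 m) x) :
    ⟪curvatureTensor m x v w z, η⟫_ℝ = 0 := by
  rw [h.inner_curvatureTensor, hv, hw, mul_zero, mul_zero, sub_zero, mul_zero]

end RiemannianManifold

section Immersion

variable {n k : ℕ}
  {M : Type*} [TopologicalSpace M] [ChartedSpace (EuclideanSpace ℝ (Fin n)) M]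
  [RiemannianBundle (fun x : M ↦ TangentSpace (𝓡 n) x)]
  {N : Type*} [TopologicalSpace N] [ChartedSpace (EuclideanSpace ℝ (Fin k)) N]
  [RiemannianBundle (fun y : N ↦ TangentSpace (𝓡 k) y)]
  {f : M → N}

theorem IsIsometricImmersion.mdifferentiable (hf : IsIsometricImmersion n k f) :
    MDifferentiable (𝓡 n) (𝓡 k) f :=
  hf.1.mdifferentiable (by simp)

variable [IsManifold (𝓡 n) ∞ M] [IsManifold (𝓡 k) ∞ N]
  [IsContMDiffRiemannianBundle (𝓡 n) ∞ (EuclideanSpace ℝ (Fin n))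
    (fun x : M ↦ TangentSpace (𝓡 n) x)]
  [IsContMDiffRiemannianBundle (𝓡 k) ∞ (EuclideanSpace ℝ (Fin k))
    (fun y : N ↦ TangentSpace (𝓡 k) y)]

theorem IsIsometricImmersion.isChartIsometricAt (hf : IsIsometricImmersion n k f) (x : M) :
    IsChartIsometricAt (chartMetric n x) (chartMetric k (f x))
      (writtenInExtChartAt (𝓡 n) (𝓡 k) x f) (extChartAt (𝓡 n) x x) where
  source := isChartMetricAt_chartMetric n x
  target := by
    rw [writtenInExtChartAt_extChartAt_self]
    exact isChartMetricAt_chartMetric k (f x)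
  contDiffAt := by
    have h := (contMDiffAt_iff.mp (hf.1.contMDiffAt (x := x))).2
    rw [ModelWithCorners.range_eq_univ, contDiffWithinAt_univ] at h
    exact h.of_le ENat.LEInfty.out
  eventually_isometric := by
    filter_upwards [eventually_extChartAt_symm_writtenInExtChartAt (𝓡 n) (𝓡 k)
      (hf.1.continuous.continuousAt (x := x)),
      eventually_mfderiv_extChartAt_symm_fderiv hf.mdifferentiable x] with u hlift hderiv v w
    rw [chartMetric_apply, chartMetric_apply, hderiv, hderiv, hlift.2]
    exact hf.2 _ _ _

end Immersion

section RiemannianManifold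

theorem finrank_tangentSpace {m : ℕ} {M : Type*} [TopologicalSpace M]
    [ChartedSpace (EuclideanSpace ℝ (Fin m)) M] (x : M) :
    Module.finrank ℝ (TangentSpace (𝓡 m) x) = m :=
  finrank_euclideanSpace_fin (𝕜 := ℝ) (n := m)

variable {m : ℕ} {M : Type*} [TopologicalSpace M] [ChartedSpace (EuclideanSpace ℝ (Fin m)) M]
  [RiemannianBundle (fun x : M ↦ TangentSpace (𝓡 m) x)] [IsManifold (𝓡 m) ∞ M]
  [IsContMDiffRiemannianBundle (𝓡 m) ∞ (EuclideanSpace ℝ (Fin m))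
    (fun x : M ↦ TangentSpace (𝓡 m) x)]

theorem sectionalCurvature_comm (x : M) (v w : TangentSpace (𝓡 m) x) :
    sectionalCurvature m x v w = sectionalCurvature m x w v := by
  have hT := isCurvatureLike_inner_curvatureTensor m x
  rw [sectionalCurvature, sectionalCurvature, hT.swap_left, hT.swap_right, neg_neg,
    mul_comm (‖v‖ ^ 2), real_inner_comm v w]

theorem two_mul_scalarCurvature (x : M) :
    2 * scalarCurvature m x = ∑ i, ∑ j ∈ {i}ᶜ, sectionalCurvature m x
      (stdOrthonormalBasis ℝ (TangentSpace (𝓡 m) x) i)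
      (stdOrthonormalBasis ℝ (TangentSpace (𝓡 m) x) j) := by
  let e := stdOrthonormalBasis ℝ (TangentSpace (𝓡 m) x)
  calc 2 * scalarCurvature m x
      = ∑ i, ∑ j ∈ Finset.Ioi i, (sectionalCurvature m x (e i) (e j) +
          sectionalCurvature m x (e j) (e i)) := by
        simp only [scalarCurvature, Finset.mul_sum, ← Finset.sum_filter, Finset.filter_lt_eq_Ioi]
        refine Finset.sum_congr rfl fun i _ ↦ Finset.sum_congr rfl fun j _ ↦ ?_
        rw [sectionalCurvature_comm x (e j), ← two_mul]
    _ = ∑ i, ∑ j ∈ {i}ᶜ, sectionalCurvature m x (e i) (e j) :=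
        Finset.sum_sum_Ioi_add_eq_sum_sum_off_diag
          fun j i ↦ sectionalCurvature m x (e i) (e j)

end RiemannianManifold

section Immersion

variable {n k : ℕ}
  {M : Type*} [TopologicalSpace M] [ChartedSpace (EuclideanSpace ℝ (Fin n)) M]
  {N : Type*} [TopologicalSpace N] [ChartedSpace (EuclideanSpace ℝ (Fin k)) N]
  [IsManifold (𝓡 k) ∞ N] [RiemannianBundle (fun y : N ↦ TangentSpace (𝓡 k) y)]

theorem chartMetric_writtenInExtChartAt (f : M → N) (x : M) (v w : TangentSpace (𝓡 k) (f x)) :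
    chartMetric k (f x) (writtenInExtChartAt (𝓡 n) (𝓡 k) x f (extChartAt (𝓡 n) x x)) v w =
      ⟪v, w⟫_ℝ := by
  rw [writtenInExtChartAt_extChartAt_self]
  exact chartMetric_self k (f x) v w

variable [IsManifold (𝓡 n) ∞ M] [RiemannianBundle (fun x : M ↦ TangentSpace (𝓡 n) x)]
  [IsContMDiffRiemannianBundle (𝓡 n) ∞ (EuclideanSpace ℝ (Fin n))
    (fun x : M ↦ TangentSpace (𝓡 n) x)]
  [IsContMDiffRiemannianBundle (𝓡 k) ∞ (EuclideanSpace ℝ (Fin k))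
    (fun y : N ↦ TangentSpace (𝓡 k) y)]
  {f : M → N} (hf : IsIsometricImmersion n k f) (x : M)

include hf

theorem IsIsometricImmersion.secondFundamentalForm_comm (v w : TangentSpace (𝓡 n) x) :
    secondFundamentalForm n k f x v w = secondFundamentalForm n k f x w v :=
  (hf.isChartIsometricAt x).secondFundamentalForm_comm v w

/-- The second fundamental form as a bilinear map; linearity in the second argument comes from
the symmetry, which is why the immersion hypothesis is an argument. -/
def IsIsometricImmersion.secondFundamentalFormₗ :
    TangentSpace (𝓡 n) x →ₗ[ℝ] TangentSpace (𝓡 n) x →ₗ[ℝ] TangentSpace (𝓡 k) (f x) :=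
  have hadd (v v' w : TangentSpace (𝓡 n) x) : secondFundamentalForm n k f x (v + v') w =
      secondFundamentalForm n k f x v w + secondFundamentalForm n k f x v' w :=
    chartSecondFundamentalForm_add_left (chartMetric n x) (chartMetric k (f x)) _ _ v v' w
  have hsmul (a : ℝ) (v w : TangentSpace (𝓡 n) x) : secondFundamentalForm n k f x (a • v) w =
      a • secondFundamentalForm n k f x v w :=
    chartSecondFundamentalForm_smul_left (chartMetric n x) (chartMetric k (f x)) _ a _ v w
  LinearMap.mk₂ ℝ (secondFundamentalForm n k f x) hadd hsmul
    (fun v w w' ↦ by simp only [hf.secondFundamentalForm_comm x v, hadd])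
    (fun a v w ↦ by simp only [hf.secondFundamentalForm_comm x v, hsmul])

theorem IsIsometricImmersion.secondFundamentalFormₗ_apply (v w : TangentSpace (𝓡 n) x) :
    hf.secondFundamentalFormₗ x v w = secondFundamentalForm n k f x v w := rfl

theorem IsIsometricImmersion.secondFundamentalForm_mem_normalSpace (v w : TangentSpace (𝓡 n) x) :
    secondFundamentalForm n k f x v w ∈ normalSpace n k f x := by
  rw [normalSpace, Submodule.mem_orthogonal']
  rintro _ ⟨z, rfl⟩
  have hnormal := (hf.isChartIsometricAt x).metric_secondFundamentalForm_fderiv v w z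
  rw [fderiv_writtenInExtChartAt (hf.mdifferentiable x)] at hnormal
  exact (chartMetric_writtenInExtChartAt f x _ _).symm.trans hnormal

theorem IsIsometricImmersion.gauss (v w z z' : TangentSpace (𝓡 n) x) :
    ⟪curvatureTensor n x v w z, z'⟫_ℝ =
      ⟪curvatureTensor k (f x) (mfderiv (𝓡 n) (𝓡 k) f x v) (mfderiv (𝓡 n) (𝓡 k) f x w)
          (mfderiv (𝓡 n) (𝓡 k) f x z), mfderiv (𝓡 n) (𝓡 k) f x z'⟫_ℝ +
        ⟪secondFundamentalForm n k f x w z, secondFundamentalForm n k f x v z'⟫_ℝ -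
        ⟪secondFundamentalForm n k f x v z, secondFundamentalForm n k f x w z'⟫_ℝ := by
  have hgauss := (hf.isChartIsometricAt x).gauss v w z z'
  rw [fderiv_writtenInExtChartAt (hf.mdifferentiable x), writtenInExtChartAt_extChartAt_self]
    at hgauss
  simp only [← chartMetric_self]
  exact hgauss

theorem IsIsometricImmersion.deltaCasorati_eq :
    deltaCasorati n k f x =
      1 / 2 * (1 / n * hsNormSq (hf.secondFundamentalFormₗ x)) + ((n : ℝ) + 1) / (2 * n) *
        sInf (hyperplaneCasoratiCurvatures n (hf.secondFundamentalFormₗ x)) :=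
  rfl

variable {c : ℝ} (hN : HasConstantSectionalCurvatureAt k (f x) c)

include hN

theorem IsIsometricImmersion.sectionalCurvature_eq {v w : TangentSpace (𝓡 n) x} (hv : ‖v‖ = 1)
    (hw : ‖w‖ = 1) (hvw : ⟪v, w⟫_ℝ = 0) :
    sectionalCurvature n x v w =
      ⟪secondFundamentalForm n k f x v v, secondFundamentalForm n k f x w w⟫_ℝ -
        ‖secondFundamentalForm n k f x v w‖ ^ 2 + c := by
  rw [sectionalCurvature, hf.gauss, hN.inner_curvatureTensor, hf.2, hf.2, hf.2, hf.2,
    real_inner_self_eq_norm_sq, real_inner_self_eq_norm_sq, hv, hw, hvw,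
    hf.secondFundamentalForm_comm x w v, real_inner_self_eq_norm_sq,
    real_inner_comm (secondFundamentalForm n k f x v v)]
  ring

theorem IsIsometricImmersion.normalizedScalarCurvature_eq (hn : 2 ≤ n) :
    normalizedScalarCurvature n x =
      (‖metricTrace (hf.secondFundamentalFormₗ x)‖ ^ 2 - hsNormSq (hf.secondFundamentalFormₗ x)) /
        (n * ((n : ℝ) - 1)) + c := by
  let e := stdOrthonormalBasis ℝ (TangentSpace (𝓡 n) x)
  have hscalar : 2 * scalarCurvature n x = ‖metricTrace (hf.secondFundamentalFormₗ x)‖ ^ 2 -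
      hsNormSq (hf.secondFundamentalFormₗ x) + n * ((n : ℝ) - 1) * c := by
    have hentry (i) (j) (hj : j ∈ ({i}ᶜ : Finset _)) : sectionalCurvature n x (e i) (e j) =
        ⟪hf.secondFundamentalFormₗ x (e i) (e i), hf.secondFundamentalFormₗ x (e j) (e j)⟫_ℝ -
          ‖hf.secondFundamentalFormₗ x (e i) (e j)‖ ^ 2 + c :=
      hf.sectionalCurvature_eq x hN (e.norm_eq_one i) (e.norm_eq_one j)
        (e.inner_eq_zero (Ne.symm (by simpa using hj)))
    have hcard : ((n - 1 : ℕ) : ℝ) = n - 1 := Nat.cast_pred (by omega)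
    rw [two_mul_scalarCurvature, norm_metricTrace_sq_sub_hsNormSq e,
      Finset.sum_congr rfl fun i _ ↦ Finset.sum_congr rfl (hentry i)]
    simp [Finset.sum_add_distrib, Finset.card_compl, finrank_tangentSpace, hcard, mul_assoc]
  have hn' : (2 : ℝ) ≤ n := by exact_mod_cast hn
  have hne : (n : ℝ) * (n - 1) ≠ 0 := mul_ne_zero (by linarith) (by linarith)
  rw [normalizedScalarCurvature, hscalar, add_div, mul_div_cancel_left₀ c hne]

theorem IsIsometricImmersion.normalizedScalarCurvature_le (hn : 2 ≤ n) :
    normalizedScalarCurvature n x ≤ deltaCasorati n k f x + c := by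
  rw [hf.normalizedScalarCurvature_eq x hN hn, hf.deltaCasorati_eq x]
  exact add_le_add_left
    (casorati_inequality (hf.secondFundamentalFormₗ x) (finrank_tangentSpace x) hn) c

theorem IsIsometricImmersion.normalizedScalarCurvature_eq_iff (hn : 2 ≤ n) :
    normalizedScalarCurvature n x = deltaCasorati n k f x + c ↔
      IsCasoratiIdeal (hf.secondFundamentalFormₗ x) := by
  rw [hf.normalizedScalarCurvature_eq x hN hn, hf.deltaCasorati_eq x, add_left_inj,
    casorati_equality_iff (B := hf.secondFundamentalFormₗ x) (finrank_tangentSpace x) hn]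

end Immersion

theorem exists_orthonormalBasis_inner_eq_ite {V : Type*} [NormedAddCommGroup V]
    [InnerProductSpace ℝ V] [FiniteDimensional ℝ V] {p : ℕ} (hV : Module.finrank ℝ V = p) (Λ : V) :
    ∃ (ξ : OrthonormalBasis (Fin p) ℝ V) (a : ℝ),
      ∀ r : Fin p, ⟪Λ, ξ r⟫_ℝ = if (r : ℕ) = 0 then a else 0 := by
  rcases eq_or_ne Λ 0 with rfl | hΛ
  · exact ⟨(stdOrthonormalBasis ℝ V).reindex (finCongr hV), 0, fun r ↦ by simp⟩
  have : Nontrivial V := ⟨Λ, 0, hΛ⟩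
  have : NeZero p := ⟨hV ▸ Module.finrank_pos.ne'⟩
  obtain ⟨ξ, hξ⟩ := exists_orthonormalBasis_apply_eq (ι := Fin p) (by simpa using hV) 0
    (norm_smul_inv_norm (𝕜 := ℝ) hΛ)
  refine ⟨ξ, ‖Λ‖, fun r ↦ ?_⟩
  have hΛξ : Λ = ‖Λ‖ • ξ 0 := by
    rw [hξ]
    exact (smul_inv_smul₀ (norm_ne_zero_iff.mpr hΛ) Λ).symm
  conv_lhs => rw [hΛξ, real_inner_smul_left, ξ.inner_eq_ite]
  simp only [eq_comm (a := (0 : Fin p)), Fin.ext_iff, Fin.val_zero, mul_ite, mul_one, mul_zero]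

section Normal

variable {n k p : ℕ}
  {M : Type*} [TopologicalSpace M] [ChartedSpace (EuclideanSpace ℝ (Fin n)) M]
  [RiemannianBundle (fun x : M ↦ TangentSpace (𝓡 n) x)]
  {N : Type*} [TopologicalSpace N] [ChartedSpace (EuclideanSpace ℝ (Fin k)) N]
  [RiemannianBundle (fun y : N ↦ TangentSpace (𝓡 k) y)]
  {f : M → N} (hf : IsIsometricImmersion n k f) (x : M)

include hf

theorem IsIsometricImmersion.injective_mfderiv :
    Function.Injective (mfderiv (𝓡 n) (𝓡 k) f x) :=
  (injective_iff_map_eq_zero _).mpr fun v hv ↦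
    inner_self_eq_zero (𝕜 := ℝ) |>.mp (by rw [← hf.2, hv, inner_zero_left])

theorem IsIsometricImmersion.finrank_normalSpace :
    n + Module.finrank ℝ (normalSpace n k f x) = k := by
  have hrange := LinearMap.finrank_range_of_inj (hf.injective_mfderiv x)
  have hsum := (LinearMap.range (mfderiv (𝓡 n) (𝓡 k) f x :
    TangentSpace (𝓡 n) x →ₗ[ℝ] TangentSpace (𝓡 k) (f x))).finrank_add_finrank_orthogonal
  rwa [hrange, finrank_tangentSpace, finrank_tangentSpace] at hsum

variable [IsManifold (𝓡 n) ∞ M]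
  [IsContMDiffRiemannianBundle (𝓡 n) ∞ (EuclideanSpace ℝ (Fin n))
    (fun x : M ↦ TangentSpace (𝓡 n) x)]
  [IsManifold (𝓡 k) ∞ N]
  [IsContMDiffRiemannianBundle (𝓡 k) ∞ (EuclideanSpace ℝ (Fin k))
    (fun y : N ↦ TangentSpace (𝓡 k) y)]

theorem IsIsometricImmersion.inner_shapeOperator (ξ : TangentSpace (𝓡 k) (f x))
    (v w : TangentSpace (𝓡 n) x) :
    ⟪shapeOperator n k f x ξ v, w⟫_ℝ = ⟪hf.secondFundamentalFormₗ x v w, ξ⟫_ℝ := by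
  let e := stdOrthonormalBasis ℝ (TangentSpace (𝓡 n) x)
  have hA : shapeOperator n k f x ξ v =
      ∑ i, ⟪hf.secondFundamentalFormₗ x v (e i), ξ⟫_ℝ • e i := rfl
  conv_rhs => rw [← e.sum_repr' w]
  simp only [hA, map_sum, map_smul, sum_inner, real_inner_smul_left, mul_comm]

theorem IsIsometricImmersion.toMatrix_shapeOperator {ι : Type*} [Fintype ι] [DecidableEq ι]
    (e : OrthonormalBasis ι ℝ (TangentSpace (𝓡 n) x)) (ξ : TangentSpace (𝓡 k) (f x)) (i j : ι) :
    LinearMap.toMatrix e.toBasis e.toBasis (shapeOperator n k f x ξ) i j =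
      ⟪hf.secondFundamentalFormₗ x (e i) (e j), ξ⟫_ℝ := by
  rw [LinearMap.toMatrix_apply, e.coe_toBasis, e.coe_toBasis_repr_apply, e.repr_apply_apply,
    real_inner_comm, hf.inner_shapeOperator x, hf.secondFundamentalFormₗ_apply,
    hf.secondFundamentalFormₗ_apply, hf.secondFundamentalForm_comm]

theorem IsIsometricImmersion.isInvariantlyQuasiUmbilicalAt_of_isCasoratiIdeal (hk : n + p = k)
    (hideal : IsCasoratiIdeal (hf.secondFundamentalFormₗ x)) :
    IsInvariantlyQuasiUmbilicalAt n k p f x := by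
  obtain ⟨e, Λ, he, hform⟩ := hideal
  have hp : Module.finrank ℝ (normalSpace n k f x) = p := by
    have := hf.finrank_normalSpace x
    omega
  have hshape (ξ v) : shapeOperator n k f x ξ v = ⟪Λ, ξ⟫_ℝ • (v + ⟪e, v⟫_ℝ • e) := by
    refine ext_inner_right ℝ fun w ↦ ?_
    rw [hf.inner_shapeOperator, hform, casoratiForm_apply, real_inner_smul_left,
      real_inner_smul_left, inner_add_left, real_inner_smul_left, mul_comm]
  let ξ := (stdOrthonormalBasis ℝ (normalSpace n k f x)).reindex (finCongr hp)
  refine ⟨ξ, e, he, fun r ↦ ⟨⟪Λ, ξ r⟫_ℝ, 2 * ⟪Λ, ξ r⟫_ℝ, ?_, fun v hv ↦ ?_⟩⟩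
  · rw [hshape, real_inner_self_eq_norm_sq, he, one_pow, one_smul, ← two_smul ℝ, smul_smul,
      mul_comm]
  · rw [hshape, real_inner_comm v e, hv, zero_smul, add_zero]

theorem IsIsometricImmersion.hasTrivialNormalConnectionAt_of_isCasoratiIdeal {c : ℝ}
    (hN : HasConstantSectionalCurvatureAt k (f x) c)
    (hideal : IsCasoratiIdeal (hf.secondFundamentalFormₗ x)) :
    HasTrivialNormalConnectionAt n k f x := by
  intro ξ hξ hnormal v w
  set φ := writtenInExtChartAt (𝓡 n) (𝓡 k) x f
  set u := extChartAt (𝓡 n) x x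
  have hξ₂ : ContDiffAt ℝ 2 ξ u := hξ.of_le ENat.LEInfty.out
  have hweingarten (v z : TangentSpace (𝓡 n) x) :
      inner ℝ (E := TangentSpace (𝓡 n) x)
        (chartTangentialDeriv (chartMetric n x) (chartMetric k (f x)) φ ξ u v) z =
        -inner ℝ (E := TangentSpace (𝓡 k) (f x)) (hf.secondFundamentalFormₗ x v z) (ξ u) :=
    (chartMetric_self n x _ z).symm.trans <|
      ((hf.isChartIsometricAt x).weingarten (hξ₂.differentiableAt (by norm_num)) hnormal v z).trans
        (congrArg Neg.neg (chartMetric_writtenInExtChartAt f x _ _))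
  refine (hf.isChartIsometricAt x).normalCurvature_eq_zero hξ₂ (fun η hη ↦ ?_)
    (hideal.apply_comm (hweingarten v) (hweingarten w))
  have hη' (z : EuclideanSpace ℝ (Fin n)) :
      inner ℝ (E := TangentSpace (𝓡 k) (f x)) (fderiv ℝ φ u z) η = 0 :=
    (chartMetric_writtenInExtChartAt f x _ η).symm.trans (hη z)
  rw [writtenInExtChartAt_extChartAt_self]
  exact (chartMetric_self k (f x) _ η).trans
    (hN.inner_curvatureTensor_eq_zero (hη' v) (hη' w) (ξ u))

theorem IsIsometricImmersion.secondFundamentalFormₗ_eq_casoratiForm_iff {ι κ : Type*} [Fintype ι]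
    [DecidableEq ι] [Fintype κ] (e : OrthonormalBasis ι ℝ (TangentSpace (𝓡 n) x)) (i₀ : ι)
    (ξ : OrthonormalBasis κ ℝ (normalSpace n k f x)) (Λ : normalSpace n k f x) :
    hf.secondFundamentalFormₗ x = casoratiForm (e i₀) (Λ : TangentSpace (𝓡 k) (f x)) ↔
      ∀ r, LinearMap.toMatrix e.toBasis e.toBasis
          (shapeOperator n k f x (ξ r : TangentSpace (𝓡 k) (f x))) =
        Matrix.diagonal fun i ↦ if i = i₀ then 2 * ⟪Λ, ξ r⟫_ℝ else ⟪Λ, ξ r⟫_ℝ := by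
  have hentry (i j r) : (Matrix.diagonal fun i ↦ if i = i₀ then 2 * ⟪Λ, ξ r⟫_ℝ else ⟪Λ, ξ r⟫_ℝ)
      i j = ⟪casoratiForm (e i₀) (Λ : TangentSpace (𝓡 k) (f x)) (e i) (e j),
        (ξ r : TangentSpace (𝓡 k) (f x))⟫_ℝ := by
    rw [casoratiForm_apply, real_inner_smul_left, e.inner_eq_ite, e.inner_eq_ite, e.inner_eq_ite,
      Matrix.diagonal_apply, ← Submodule.coe_inner]
    grind
  simp only [← Matrix.ext_iff, hf.toMatrix_shapeOperator x, hentry]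
  refine ⟨fun h _ _ _ ↦ by rw [h], fun h ↦ e.toBasis.ext fun i ↦ e.toBasis.ext fun j ↦ ?_⟩
  rw [e.coe_toBasis]
  have hmem : casoratiForm (e i₀) (Λ : TangentSpace (𝓡 k) (f x)) (e i) (e j) ∈
      normalSpace n k f x := by
    rw [casoratiForm_apply]
    exact Submodule.smul_mem _ _ Λ.2
  exact congrArg Subtype.val <| InnerProductSpace.ext_inner_right_basis
    (x := ⟨_, hf.secondFundamentalForm_mem_normalSpace x (e i) (e j)⟩) (y := ⟨_, hmem⟩) ξ.toBasis
    fun r ↦ by rw [ξ.coe_toBasis]; exact h r i j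

theorem IsIsometricImmersion.mem_normalSpace_of_eq_casoratiForm {e : TangentSpace (𝓡 n) x}
    (he : ‖e‖ = 1) {Λ : TangentSpace (𝓡 k) (f x)}
    (hform : hf.secondFundamentalFormₗ x = casoratiForm e Λ) : Λ ∈ normalSpace n k f x := by
  have hee : secondFundamentalForm n k f x e e = (2 : ℝ) • Λ := by
    rw [← hf.secondFundamentalFormₗ_apply, hform, casoratiForm_apply, real_inner_self_eq_norm_sq,
      he]
    norm_num
  exact (Submodule.smul_mem_iff _ (two_ne_zero (α := ℝ))).mp
    (hee ▸ hf.secondFundamentalForm_mem_normalSpace x e e)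

theorem IsIsometricImmersion.isCasoratiIdeal_iff_exists_toMatrix (hn : 0 < n) (hk : n + p = k) :
    IsCasoratiIdeal (hf.secondFundamentalFormₗ x) ↔
      ∃ (e : OrthonormalBasis (Fin n) ℝ (TangentSpace (𝓡 n) x))
        (ξ : OrthonormalBasis (Fin p) ℝ (normalSpace n k f x)) (l : ℝ), ∀ r : Fin p,
        LinearMap.toMatrix e.toBasis e.toBasis
            (shapeOperator n k f x (ξ r : TangentSpace (𝓡 k) (f x))) =
          if (r : ℕ) = 0 then
            Matrix.diagonal (fun i : Fin n ↦ if (i : ℕ) + 1 = n then 2 * l else l)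
          else 0 := by
  let i₀ : Fin n := ⟨n - 1, by omega⟩
  have hi₀ (i : Fin n) : (i : ℕ) + 1 = n ↔ i = i₀ := by
    simp only [i₀, Fin.ext_iff]
    omega
  have hdiag (l : ℝ) (r : Fin p) : (if (r : ℕ) = 0 then
      Matrix.diagonal (fun i : Fin n ↦ if (i : ℕ) + 1 = n then 2 * l else l) else 0) =
      Matrix.diagonal (fun i ↦ if i = i₀ then 2 * (if (r : ℕ) = 0 then l else 0)
        else (if (r : ℕ) = 0 then l else 0)) := by
    split_ifs <;> simp [hi₀]
  simp only [hdiag]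
  constructor
  · rintro ⟨v, Λ, hv, hform⟩
    have hΛ := hf.mem_normalSpace_of_eq_casoratiForm x hv hform
    have hcard : Module.finrank ℝ (TangentSpace (𝓡 n) x) = Fintype.card (Fin n) := by
      rw [finrank_tangentSpace, Fintype.card_fin]
    obtain ⟨e, rfl⟩ := exists_orthonormalBasis_apply_eq hcard i₀ hv
    have hp : Module.finrank ℝ (normalSpace n k f x) = p := by
      have := hf.finrank_normalSpace x
      omega
    obtain ⟨ξ, l, hξ⟩ := exists_orthonormalBasis_inner_eq_ite hp ⟨Λ, hΛ⟩
    refine ⟨e, ξ, l, ?_⟩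
    simpa only [hξ] using (hf.secondFundamentalFormₗ_eq_casoratiForm_iff x e i₀ ξ ⟨Λ, hΛ⟩).1 hform
  · rintro ⟨e, ξ, l, hmatrix⟩
    let Λ := ∑ r : Fin p, (if (r : ℕ) = 0 then l else 0) • ξ r
    have hΛ (r : Fin p) : ⟪Λ, ξ r⟫_ℝ = if (r : ℕ) = 0 then l else 0 :=
      ξ.orthonormal.inner_left_fintype _ r
    refine ⟨e i₀, Λ, e.norm_eq_one i₀, ?_⟩
    rw [hf.secondFundamentalFormₗ_eq_casoratiForm_iff x e i₀ ξ Λ]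
    simpa only [hΛ] using hmatrix

end Normal

end Casorati

end

theorem theorem4p1_general (n p : ℕ) (hn : 2 ≤ n) (c : ℝ)
    {M : Type*} [TopologicalSpace M] [ChartedSpace (EuclideanSpace ℝ (Fin n)) M]
    [IsManifold (𝓡 n) ∞ M]
    [RiemannianBundle (fun x : M ↦ TangentSpace (𝓡 n) x)]
    [IsContMDiffRiemannianBundle (𝓡 n) ∞ (EuclideanSpace ℝ (Fin n))
      (fun x : M ↦ TangentSpace (𝓡 n) x)]
    {N : Type*} [TopologicalSpace N] [ChartedSpace (EuclideanSpace ℝ (Fin (n + p))) N]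
    [IsManifold (𝓡 (n + p)) ∞ N]
    [RiemannianBundle (fun y : N ↦ TangentSpace (𝓡 (n + p)) y)]
    [IsContMDiffRiemannianBundle (𝓡 (n + p)) ∞ (EuclideanSpace ℝ (Fin (n + p)))
      (fun y : N ↦ TangentSpace (𝓡 (n + p)) y)]
    (f : M → N) (hf : Casorati.IsIsometricImmersion n (n + p) f) (x : M)
    (hN : Casorati.HasConstantSectionalCurvatureAt (n + p) (f x) c) :
    Casorati.normalizedScalarCurvature n x
        ≤ Casorati.deltaCasorati n (n + p) f x + c ∧
    (Casorati.normalizedScalarCurvature n x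
        = Casorati.deltaCasorati n (n + p) f x + c ↔
      Casorati.IsInvariantlyQuasiUmbilicalAt n (n + p) p f x ∧
      Casorati.HasTrivialNormalConnectionAt n (n + p) f x ∧
      ∃ (e : OrthonormalBasis (Fin n) ℝ (TangentSpace (𝓡 n) x))
        (ξ : OrthonormalBasis (Fin p) ℝ (Casorati.normalSpace n (n + p) f x))
        (l : ℝ), ∀ r : Fin p,
        LinearMap.toMatrix e.toBasis e.toBasis
            (Casorati.shapeOperator n (n + p) f x
              (ξ r : TangentSpace (𝓡 (n + p)) (f x))) =
          if (r : ℕ) = 0 then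
            Matrix.diagonal (fun i : Fin n ↦ if (i : ℕ) + 1 = n then 2 * l else l)
          else 0) := by
  have hmatrix := hf.isCasoratiIdeal_iff_exists_toMatrix x (p := p) (by omega) rfl
  refine ⟨hf.normalizedScalarCurvature_le x hN hn,
    (hf.normalizedScalarCurvature_eq_iff x hN hn).trans ⟨fun hideal ↦ ?_, fun h ↦ hmatrix.2 h.2.2⟩⟩
  exact ⟨hf.isInvariantlyQuasiUmbilicalAt_of_isCasoratiIdeal x rfl hideal,
    hf.hasTrivialNormalConnectionAt_of_isCasoratiIdeal x hN hideal, hmatrix.1 hideal⟩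

theorem theorem4p1 (n p : ℕ) (hn : 2 ≤ n) (c : ℝ)
    {M : Type*} [TopologicalSpace M] [ChartedSpace (EuclideanSpace ℝ (Fin n)) M]
    [IsManifold (𝓡 n) ∞ M]
    [RiemannianBundle (fun x : M ↦ TangentSpace (𝓡 n) x)]
    [IsContMDiffRiemannianBundle (𝓡 n) ∞ (EuclideanSpace ℝ (Fin n))
      (fun x : M ↦ TangentSpace (𝓡 n) x)]
    {N : Type*} [TopologicalSpace N] [ChartedSpace (EuclideanSpace ℝ (Fin (n + p))) N]
    [IsManifold (𝓡 (n + p)) ∞ N]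
    [RiemannianBundle (fun y : N ↦ TangentSpace (𝓡 (n + p)) y)]
    [IsContMDiffRiemannianBundle (𝓡 (n + p)) ∞ (EuclideanSpace ℝ (Fin (n + p)))
      (fun y : N ↦ TangentSpace (𝓡 (n + p)) y)]
    (hN : Casorati.HasConstantSectionalCurvature (n + p) N c)
    (f : M → N) (hf : Casorati.IsIsometricImmersion n (n + p) f) (x : M) :
    Casorati.normalizedScalarCurvature n x
        ≤ Casorati.deltaCasorati n (n + p) f x + c ∧
    (Casorati.normalizedScalarCurvature n x
        = Casorati.deltaCasorati n (n + p) f x + c ↔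
      Casorati.IsInvariantlyQuasiUmbilicalAt n (n + p) p f x ∧
      Casorati.HasTrivialNormalConnectionAt n (n + p) f x ∧
      ∃ (e : OrthonormalBasis (Fin n) ℝ (TangentSpace (𝓡 n) x))
        (ξ : OrthonormalBasis (Fin p) ℝ (Casorati.normalSpace n (n + p) f x))
        (l : ℝ), ∀ r : Fin p,
        LinearMap.toMatrix e.toBasis e.toBasis
            (Casorati.shapeOperator n (n + p) f x
              (ξ r : TangentSpace (𝓡 (n + p)) (f x))) =
          if (r : ℕ) = 0 then
            Matrix.diagonal (fun i : Fin n ↦ if (i : ℕ) + 1 = n then 2 * l else l)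
          else 0) :=
  theorem4p1_general n p hn c f hf x (hN (f x))
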